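/- **Theorem 5.** For $0<q<1$ let $$R(q)=\cfrac{q^{1/5}}{1+\cfrac{q}{1+\cfrac{q^2}{1+\cdots}}}$$ be the Rogers–Ramanujan continued fraction, and let $\eta(\tau)=e^{\pi i\tau/12}\prod_{k\ge1}(1-e^{2\pi i k\tau})$ be the Dedekind eta function. Let $G$ be a real function that is smooth on $\left(0,\frac{\sqrt5-1}{2}\right)$ (the interval of values of $R$), such that for every $r>0$ the integral $$m_G^{(-1)}(r)=\pi\int_{\sqrt r}^{\infty}\eta(it/2)^4\,G\!\left(R(e^{-\pi t})\right)dt$$ converges absolutely, and such that $m_G^{(-1)}$ is injective on $(0,\infty)$. Let $m_G$ be its inverse function, defined on $\{m_G^{(-1)}(r): r>0\}$. Let $y=y_G$ be the function obtained by inverting $$A=5\int_0^{y}\frac{G(t)}{t\,\sqrt[6]{t^{-5}-11-t^{5}}}\,dt ,\qquad 0<y<\tfrac{\sqrt5-1}{2}.$$ Let $n\ge1$ be an integer, and let $\Omega_n$ be the modular equation of degree $n$ of $R$, that is, $\Omega_n(x)=R\big((R^{(-1)}(x))^n\big)$, where $R^{(-1)}$ is the inverse of $R$ on $(0,1)$.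 Then $R(q^n)=\Omega_n(R(q))$ for all $0<q<1$, and with $$Q^*_{n^2}(A)=m_G^{(-1)}\!\left(n^2\, m_G(A)\right)$$ one has $$y\!\left(Q^*_{n^2}(A)\right)=\Omega_n\!\left(y(A)\right)$$ for every $A$ in the domain of $m_G$, i.e. every $A=m_G^{(-1)}(r)$ with $r>0$. -/

import Mathlib

open Set Filter Topology
open scoped Real ContDiff

noncomputable section

/-- The Rogers-Ramanujan continued fraction as a formal continued fraction,
`q^(1/5) / (1 + q / (1 + q^2 / (1 + q^3 / (1 + ...))))`. -/
def rrContFract (q : ℝ) : GenContFract ℝ :=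
  ⟨0, Stream'.Seq.ofStream fun k : ℕ => ⟨if k = 0 then q ^ (1 / 5 : ℝ) else q ^ k, 1⟩⟩

/-- The value `R(q)` of the Rogers-Ramanujan continued fraction (for `0 < q < 1`),
the limit of its convergents. -/
def rrR (q : ℝ) : ℝ := limUnder atTop fun k : ℕ => (rrContFract q).convs k

/-- The modular equation `Ω_n` of degree `n` of `R`, solved for the new variable:
the function which sends `R(q)` to `R(q^n)` for `0 < q < 1`. -/
def rrOmega (n : ℕ) (x : ℝ) : ℝ := rrR (Function.invFunOn rrR (Ioo 0 1) x ^ n)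

/-- The integrand `η(it/2)^4 G(R(e^{-πt}))`; the number `η(it/2)` is real for `t > 0`. -/
def mIntegrand (G : ℝ → ℝ) (t : ℝ) : ℝ :=
  (ModularForm.eta (Complex.I * t / 2) ^ 4).re * G (rrR (Real.exp (-π * t)))

/-- `m_G^{(-1)}(r) = π ∫_{√r}^∞ η(it/2)^4 G(R(e^{-πt})) dt`, for `r > 0`. -/
def mInv (G : ℝ → ℝ) (r : ℝ) : ℝ := π * ∫ t in Ioi √r, mIntegrand G t

/-- `m_G`, the inverse of `m_G^{(-1)} : (0, ∞) → ℝ`: the number `m = m_G(x) > 0` satisfies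
`x = π ∫_{√m}^∞ η(it/2)^4 G(R(e^{-πt})) dt`. -/
def mFun (G : ℝ → ℝ) : ℝ → ℝ := Function.invFunOn (mInv G) (Ioi 0)

/-- The integral `5 ∫_0^y G(t) / (t (t^{-5} - 11 - t^5)^{1/6}) dt`, for `0 < y < (√5 - 1)/2`. -/
def yIntegral (G : ℝ → ℝ) (y : ℝ) : ℝ :=
  5 * ∫ t in Ioo 0 y, G t / (t * ((t ^ 5)⁻¹ - 11 - t ^ 5) ^ (1 / 6 : ℝ))

/-- The generalized function `y = y_G`, obtained by inverting the integral `yIntegral G` on the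
interval `(0, (√5 - 1)/2)`, on which `t^{-5} - 11 - t^5` is positive. -/
def yFun (G : ℝ → ℝ) : ℝ → ℝ := Function.invFunOn (yIntegral G) (Ioo 0 ((√5 - 1) / 2))

/-- The modular equation of `m_G^{(-1)}`: `Q*_ν(A) = m_G^{(-1)}(ν m_G(A))`. -/
def QStar (G : ℝ → ℝ) (ν A : ℝ) : ℝ := mInv G (ν * mFun G A)

end

/-! Write E(q) = ∏ (1 - q^k) and q = e^{-πt}. The substitution x = R(e^{-πt}) turns the integral
defining `yIntegral` into the one defining `mInv`, so that `yIntegral G (R(e^{-π√r})) = mInv G r`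
(`yIntegral_rrExpPi`). Since t ↦ R(e^{-πt}) maps (0, ∞) onto (0, (√5-1)/2), injectivity of `mInv`
passes to `yIntegral`, and y(`mInv G r`) = R(e^{-π√r}) (`yFun_mInv`). Replacing r by n²r replaces q
= e^{-π√r} by q^n, which is the modular equation.

The substitution rests on two classical identities of Ramanujan: R^{-5} - 11 - R^5 = E(q)^6 / (q
E(q^5)^6) (`rrR_quintic`), and dR/dt = -(π/5) R E(q)^5 / E(q^5) (`hasDerivAt_rrExpPi`). Together
they reduce |dR/dt| / (R (R^{-5} - 11 - R^5)^{1/6}) to (π/5) q^{1/6} E(q)^4 = (π/5) η(it/2)^4.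

Both need R as a quotient of theta series. The numerators and denominators of its convergents are
Schur's polynomials up to the factor q^{1/5}, and their limits are theta series divided by E(q)
(`rrR_eq_rrTheta_div`). The quintic identity follows by evaluating the Jacobi triple product at
fifth roots of unity (`rrTheta_quintic_of_root`). The derivative is a Wronskian of two theta series;
multiplication by i and by 1 + 2i on the Gaussian integers turns it into the square of Jacobi's
series for E(q)^3 (`oddTheta_wronskian_eq`). The quintic identity also determines the range of R. -/

/-! ### q-Pochhammer symbols and convergence estimates. -/

section QSeries

variable {𝕜 : Type*} [RCLike 𝕜]

/-- The finite product `(q; q)_n`. -/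
def qPoch (q : 𝕜) (n : ℕ) : 𝕜 := ∏ i ∈ Finset.range n, (1 - q ^ (i + 1))

/-- The Euler product `(q; q)_∞`. -/
noncomputable def eulerProd (q : 𝕜) : 𝕜 := ∏' i : ℕ, (1 - q ^ (i + 1))

/-- The reciprocal of `(q; q)_k`, extended by zero to negative `k`. -/
noncomputable def qPochInv (q : 𝕜) (k : ℤ) : 𝕜 := if k < 0 then 0 else (qPoch q k.toNat)⁻¹

lemma qPoch_succ (q : 𝕜) (n : ℕ) : qPoch q (n + 1) = qPoch q n * (1 - q ^ (n + 1)) :=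
  Finset.prod_range_succ _ _

lemma one_sub_pow_succ_ne_zero {q : 𝕜} (hq : ‖q‖ < 1) (n : ℕ) : 1 - q ^ (n + 1) ≠ 0 := by
  intro h
  have h1 : ‖q ^ (n + 1)‖ = 1 := by rw [← sub_eq_zero.mp h, norm_one]
  rw [norm_pow] at h1
  exact absurd h1 (pow_lt_one₀ (norm_nonneg _) hq (by omega)).ne

lemma summable_pow_succ {q : 𝕜} (hq : ‖q‖ < 1) : Summable fun n : ℕ => ‖-q ^ (n + 1)‖ := by
  simp only [norm_neg, norm_pow]
  exact (summable_nat_add_iff (f := fun n => ‖q‖ ^ n) 1).mpr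
    (summable_geometric_of_lt_one (norm_nonneg q) hq)

lemma multipliable_euler {q : 𝕜} (hq : ‖q‖ < 1) : Multipliable fun n : ℕ => 1 - q ^ (n + 1) := by
  simp only [sub_eq_add_neg]
  exact multipliable_one_add_of_summable (summable_pow_succ hq)

lemma eulerProd_ne_zero {q : 𝕜} (hq : ‖q‖ < 1) : eulerProd q ≠ 0 := by
  have := tprod_one_add_ne_zero_of_summable (f := fun n : ℕ => -q ^ (n + 1))
    (fun n => by rw [← sub_eq_add_neg]; exact one_sub_pow_succ_ne_zero hq n) (summable_pow_succ hq)
  simpa only [eulerProd, sub_eq_add_neg] using this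

lemma qPoch_ne_zero {q : 𝕜} (hq : ‖q‖ < 1) (n : ℕ) : qPoch q n ≠ 0 :=
  Finset.prod_ne_zero_iff.mpr fun i _ => one_sub_pow_succ_ne_zero hq i

lemma tendsto_qPoch {q : 𝕜} (hq : ‖q‖ < 1) :
    Tendsto (qPoch q) atTop (𝓝 (eulerProd q)) :=
  (multipliable_euler hq).hasProd.tendsto_prod_nat

lemma tendsto_qPochInv {q : 𝕜} (hq : ‖q‖ < 1) {ι : Type*} {l : Filter ι} {k : ι → ℤ}
    (hk : Tendsto k l atTop) : Tendsto (fun i => qPochInv q (k i)) l (𝓝 (eulerProd q)⁻¹) := by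
  have h1 : Tendsto (fun k : ℤ => k.toNat) atTop atTop :=
    tendsto_atTop.mpr fun b => (eventually_ge_atTop (b : ℤ)).mono fun k hk => by omega
  have h2 := (((tendsto_qPoch hq).comp h1).inv₀ (eulerProd_ne_zero hq)).comp hk
  refine h2.congr' ?_
  filter_upwards [hk.eventually_ge_atTop 0] with i hi
  simp [qPochInv, not_lt.mpr hi]

lemma exists_norm_qPochInv_le {q : 𝕜} (hq : ‖q‖ < 1) : ∃ C, 0 ≤ C ∧ ∀ k, ‖qPochInv q k‖ ≤ C := by
  have h := Metric.isBounded_range_of_tendsto _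
    ((tendsto_qPoch hq).inv₀ (eulerProd_ne_zero hq))
  obtain ⟨C, hC⟩ := h.exists_norm_le
  have h0 : 0 ≤ C := (norm_nonneg _).trans (hC _ ⟨0, rfl⟩)
  refine ⟨C, h0, fun k => ?_⟩
  unfold qPochInv
  split_ifs
  · simpa
  · exact hC _ ⟨k.toNat, rfl⟩

lemma exists_norm_qPoch_le {q : 𝕜} (hq : ‖q‖ < 1) : ∃ C, 0 ≤ C ∧ ∀ n, ‖qPoch q n‖ ≤ C := by
  obtain ⟨C, hC⟩ := (Metric.isBounded_range_of_tendsto _ (tendsto_qPoch hq)).exists_norm_le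
  exact ⟨C, (norm_nonneg _).trans (hC _ ⟨0, rfl⟩), fun n => hC _ ⟨n, rfl⟩⟩

lemma qPochInv_of_neg (q : 𝕜) {k : ℤ} (hk : k < 0) : qPochInv q k = 0 := if_pos hk

/-- The convention 1/(q; q)_k = 0 for k < 0 makes this hold at every integer, k = 0 included, so
sums over ℤ need no boundary terms. -/
lemma qPochInv_sub_one {q : 𝕜} (hq : ‖q‖ < 1) (k : ℤ) :
    qPochInv q (k - 1) = (1 - q ^ k) * qPochInv q k := by
  rcases lt_trichotomy k 0 with h | rfl | h
  · rw [qPochInv_of_neg q h, qPochInv_of_neg q (by omega), mul_zero]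
  · simp [qPochInv]
  · obtain ⟨n, rfl⟩ : ∃ n : ℕ, k = n + 1 := ⟨(k - 1).toNat, by omega⟩
    have h1 : ¬ ((n : ℤ) + 1 < 0) := by omega
    have h2 : ((n : ℤ) + 1).toNat = n + 1 := by omega
    have h3 := one_sub_pow_succ_ne_zero hq n
    have h4 := qPoch_ne_zero hq n
    simp only [qPochInv, add_sub_cancel_right, h1, h2, if_false, qPoch_succ]
    have h5 : q ^ ((n : ℤ) + 1) = q ^ (n + 1) := by exact_mod_cast rfl
    rw [h5]
    have h6 : ¬ ((n : ℤ) < 0) := by omega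
    simp only [h6, if_false, Int.toNat_natCast]
    field_simp

/-- Gaussian growth of the exponent beats every geometric and polynomial factor. -/
lemma summable_abs_pow_mul_zpow {q : 𝕜} (hq0 : q ≠ 0) (hq : ‖q‖ < 1) (z : 𝕜) (hz : z ≠ 0)
    (m : ℕ) {a b : ℝ} (ha : 0 < a) {e : ℤ → ℤ} (he : ∀ j : ℤ, (e j : ℝ) = a * j ^ 2 + b * j) :
    Summable fun j : ℤ => (|j| : ℝ) ^ m * ‖z ^ j * q ^ e j‖ := by
  have hq0' : 0 < ‖q‖ := norm_pos_iff.mpr hq0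
  have hz0' : 0 < ‖z‖ := norm_pos_iff.mpr hz
  have hl : Real.log ‖q‖ < 0 := Real.log_neg hq0' hq
  -- S, and T = -(a log‖q‖)/π below, are chosen so that the bound for Jacobi theta terms has
  -- exponent a log‖q‖ j² + |log‖z‖ + b log‖q‖| |j|.
  set S := |Real.log ‖z‖ + b * Real.log ‖q‖| / (2 * π)
  have hT : 0 < -(a * Real.log ‖q‖) / π := div_pos (by nlinarith) Real.pi_pos
  refine Summable.of_nonneg_of_le (fun j => by positivity) (fun j => ?_)
    (summable_pow_mul_jacobiTheta₂_term_bound S hT m)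
  have hn : ‖z ^ j * q ^ e j‖ = Real.exp (Real.log ‖z‖ * j + Real.log ‖q‖ * (e j : ℝ)) := by
    rw [norm_mul, norm_zpow, norm_zpow, Real.exp_add, ← Real.rpow_intCast, ← Real.rpow_intCast,
      Real.rpow_def_of_pos hz0', Real.rpow_def_of_pos hq0']
  rw [hn]
  push_cast
  refine mul_le_mul_of_nonneg_left (Real.exp_le_exp.mpr ?_) (by positivity)
  have h1 : (Real.log ‖z‖ + b * Real.log ‖q‖) * j ≤ |Real.log ‖z‖ + b * Real.log ‖q‖| * |(j : ℝ)| := by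
    rw [← abs_mul]; exact le_abs_self _
  have h2 : -π * (-(a * Real.log ‖q‖) / π * (j : ℝ) ^ 2 - 2 * S * |(j : ℝ)|) =
      a * Real.log ‖q‖ * (j : ℝ) ^ 2 + |Real.log ‖z‖ + b * Real.log ‖q‖| * |(j : ℝ)| := by
    simp only [S]
    field_simp
    ring
  rw [h2, he]
  linarith

end QSeries

/-! ### Jacobi's triple product and his series for the cube of the Euler product. -/

section TripleProduct

variable {𝕜 : Type*} [RCLike 𝕜]

/-- The general term of the theta series `∑ (-z)^j q^(j(j-1)/2)`. -/
noncomputable def thetaTerm (q z : 𝕜) (j : ℤ) : 𝕜 := (-z) ^ j * q ^ (j * (j - 1) / 2)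

/-- The coefficients by which the finite triple product deviates from the theta series. -/
noncomputable def tripleCoeff (q : 𝕜) (N : ℕ) (j : ℤ) : 𝕜 :=
  qPoch q (2 * N) * qPochInv q (N + j) * qPochInv q (N - j)

lemma triangle_succ (j : ℤ) : (j + 1) * (j + 1 - 1) / 2 = j * (j - 1) / 2 + j := by
  rw [show (j + 1) * (j + 1 - 1) = j * (j - 1) + j * 2 by ring, Int.add_mul_ediv_right _ _ two_ne_zero]

lemma cast_triangle (j : ℤ) : ((j * (j - 1) / 2 : ℤ) : ℝ) = 1 / 2 * (j : ℝ) ^ 2 + -1 / 2 * j := by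
  rw [Int.cast_div (Int.even_mul_pred_self j).two_dvd (by norm_num)]
  push_cast
  ring

lemma thetaTerm_succ {q z : 𝕜} (hq0 : q ≠ 0) (hz : z ≠ 0) (j : ℤ) :
    thetaTerm q z (j + 1) = -z * q ^ j * thetaTerm q z j := by
  unfold thetaTerm
  rw [triangle_succ, zpow_add₀ hq0, zpow_add_one₀ (neg_ne_zero.mpr hz)]
  ring

lemma tripleCoeff_eq_zero (q : 𝕜) (N : ℕ) {j : ℤ} (hj : j ∉ Finset.Icc (-N : ℤ) N) :
    tripleCoeff q N j = 0 := by
  rw [Finset.mem_Icc] at hj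
  unfold tripleCoeff
  by_cases h : (N : ℤ) + j < 0
  · rw [qPochInv_of_neg q h]; ring
  · rw [qPochInv_of_neg q (k := N - j) (by omega)]; ring

lemma summable_thetaTerm_mul_tripleCoeff (q z : 𝕜) (N : ℕ) :
    Summable fun j => thetaTerm q z j * tripleCoeff q N j :=
  summable_of_ne_finset_zero (s := Finset.Icc (-N : ℤ) N) fun j hj => by
    rw [tripleCoeff_eq_zero q N hj, mul_zero]

lemma tsum_mul_tripleCoeff (q : 𝕜) (N : ℕ) (f : ℤ → 𝕜) :
    ∑' j, f j * tripleCoeff q N j = ∑ j ∈ Finset.Icc (-N : ℤ) N, f j * tripleCoeff q N j :=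
  tsum_eq_sum fun j hj => by rw [tripleCoeff_eq_zero q N hj, mul_zero]

/-- The induction step of the finite triple product: expand the new factor (1 - z q^N)(1 -
q^{N+1}/z) and collect the power z^j. -/
lemma thetaTerm_mul_tripleCoeff_succ {q z : 𝕜} (hq0 : q ≠ 0) (hq : ‖q‖ < 1) (hz : z ≠ 0)
    (N : ℕ) (j : ℤ) : thetaTerm q z j * tripleCoeff q (N + 1) j =
      (1 + q ^ (2 * N + 1)) * (thetaTerm q z j * tripleCoeff q N j)
      - z * q ^ N * (thetaTerm q z (j - 1) * tripleCoeff q N (j - 1))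
      - q ^ (N + 1) / z * (thetaTerm q z (j + 1) * tripleCoeff q N (j + 1)) := by
  have t1 := thetaTerm_succ hq0 hz (j - 1)
  have t2 := thetaTerm_succ hq0 hz j
  rw [sub_add_cancel] at t1
  have p1 : qPoch q (2 * (N + 1)) = qPoch q (2 * N) * (1 - q ^ (2 * N + 1)) *
      (1 - q ^ (2 * N + 2)) := by
    rw [show 2 * (N + 1) = 2 * N + 1 + 1 by ring, qPoch_succ, qPoch_succ]
  have ha := qPochInv_sub_one hq (N + 1 + j)
  have ha' := qPochInv_sub_one hq (N + j)
  have hb := qPochInv_sub_one hq (N + 1 - j)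
  have hb' := qPochInv_sub_one hq (N - j)
  rw [show (N : ℤ) + 1 + j - 1 = N + j by ring] at ha
  rw [show (N : ℤ) + 1 - j - 1 = N - j by ring] at hb
  have ea : q ^ ((N : ℤ) + 1 + j) = q ^ N * q * q ^ j := by
    rw [zpow_add₀ hq0, zpow_add_one₀ hq0, zpow_natCast]
  have ea' : q ^ ((N : ℤ) + j) = q ^ N * q ^ j := by rw [zpow_add₀ hq0, zpow_natCast]
  have eb : q ^ ((N : ℤ) + 1 - j) = q ^ N * q * (q ^ j)⁻¹ := by
    rw [zpow_sub₀ hq0, zpow_add_one₀ hq0, zpow_natCast, div_eq_mul_inv]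
  have eb' : q ^ ((N : ℤ) - j) = q ^ N * (q ^ j)⁻¹ := by
    rw [zpow_sub₀ hq0, zpow_natCast, div_eq_mul_inv]
  have ej : q ^ (j - 1) = q ^ j * q⁻¹ := by rw [zpow_sub_one₀ hq0]
  have hj0 : q ^ j ≠ 0 := zpow_ne_zero _ hq0
  have t0 : thetaTerm q z (j - 1) = - z⁻¹ * q * (q ^ j)⁻¹ * thetaTerm q z j := by
    rw [t1, ej]; field_simp
  simp only [tripleCoeff]
  push_cast
  rw [p1, show (N : ℤ) + (j - 1) = N + j - 1 by ring, show (N : ℤ) - (j - 1) = N + 1 - j by ring,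
    show (N : ℤ) + (j + 1) = N + 1 + j by ring, show (N : ℤ) - (j + 1) = N - j - 1 by ring,
    ha', hb', ha, hb, t2, t0, ea, ea', eb, eb']
  field_simp
  ring

/-- The finite form of the Jacobi triple product identity. -/
lemma finite_triple_product {q z : 𝕜} (hq0 : q ≠ 0) (hq : ‖q‖ < 1) (hz : z ≠ 0) (N : ℕ) :
    ∏ k ∈ Finset.range N, ((1 - z * q ^ k) * (1 - q ^ (k + 1) / z)) =
      ∑' j, thetaTerm q z j * tripleCoeff q N j := by
  induction N with
  | zero =>
    rw [tsum_mul_tripleCoeff]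
    simp only [Finset.range_zero, Finset.prod_empty, Nat.cast_zero, neg_zero, Finset.Icc_self,
      Finset.sum_singleton, thetaTerm, tripleCoeff, qPoch, qPochInv, mul_zero, add_zero, sub_zero,
      zpow_zero, zero_mul, Int.zero_ediv, lt_irrefl, if_false, Int.toNat_zero, inv_one, mul_one]
  | succ N ih =>
    have hs := summable_thetaTerm_mul_tripleCoeff q z N
    have h1 : Summable fun j => thetaTerm q z (j - 1) * tripleCoeff q N (j - 1) :=
      hs.comp_injective (Equiv.subRight (1 : ℤ)).injective
    have h2 : Summable fun j => thetaTerm q z (j + 1) * tripleCoeff q N (j + 1) :=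
      hs.comp_injective (Equiv.addRight (1 : ℤ)).injective
    have e1 : ∑' j, thetaTerm q z (j - 1) * tripleCoeff q N (j - 1) =
        ∑' j, thetaTerm q z j * tripleCoeff q N j :=
      (Equiv.subRight (1 : ℤ)).tsum_eq fun j => thetaTerm q z j * tripleCoeff q N j
    have e2 : ∑' j, thetaTerm q z (j + 1) * tripleCoeff q N (j + 1) =
        ∑' j, thetaTerm q z j * tripleCoeff q N j :=
      (Equiv.addRight (1 : ℤ)).tsum_eq fun j => thetaTerm q z j * tripleCoeff q N j
    rw [Finset.prod_range_succ, ih,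
      tsum_congr fun j => thetaTerm_mul_tripleCoeff_succ hq0 hq hz N j,
      Summable.tsum_sub ((hs.mul_left _).sub (h1.mul_left _)) (h2.mul_left _),
      Summable.tsum_sub (hs.mul_left _) (h1.mul_left _), tsum_mul_left, tsum_mul_left,
      tsum_mul_left, e1, e2]
    field_simp
    ring

lemma summable_abs_pow_mul_thetaTerm {q z : 𝕜} (hq0 : q ≠ 0) (hq : ‖q‖ < 1) (hz : z ≠ 0)
    (m : ℕ) : Summable fun j : ℤ => (|j| : ℝ) ^ m * ‖thetaTerm q z j‖ :=
  summable_abs_pow_mul_zpow hq0 hq (-z) (neg_ne_zero.mpr hz) m (by norm_num) cast_triangle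

lemma summable_thetaTerm {q z : 𝕜} (hq0 : q ≠ 0) (hq : ‖q‖ < 1) (hz : z ≠ 0) :
    Summable (thetaTerm q z) :=
  Summable.of_norm (by simpa using summable_abs_pow_mul_thetaTerm hq0 hq hz 0)

/-- Passage to the limit in the finite theta series, with polynomial weights. -/
lemma tendsto_tsum_mul_tripleCoeff {q : 𝕜} (hq : ‖q‖ < 1) {f : ℤ → 𝕜}
    (hf : Summable fun j => ‖f j‖) :
    Tendsto (fun N => ∑' j, f j * tripleCoeff q N j) atTop (𝓝 ((∑' j, f j) * (eulerProd q)⁻¹)) := by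
  obtain ⟨C, hC0, hC⟩ := exists_norm_qPochInv_le hq
  obtain ⟨D, hD0, hD⟩ := exists_norm_qPoch_le hq
  rw [← tsum_mul_right]
  refine tendsto_tsum_of_dominated_convergence (hf.mul_right (D * C * C)) (fun j => ?_)
    (.of_forall fun N j => ?_)
  · have hN : Tendsto (fun N : ℕ => (N : ℤ)) atTop atTop := tendsto_natCast_atTop_atTop
    have h1 := tendsto_qPochInv hq (tendsto_atTop_add_const_right _ j hN)
    have h2 := tendsto_qPochInv hq (tendsto_atTop_add_const_right _ (-j) hN)
    have h3 : Tendsto (fun N : ℕ => qPoch q (2 * N)) atTop (𝓝 (eulerProd q)) :=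
      (tendsto_qPoch hq).comp (tendsto_id.const_mul_atTop' two_pos)
    have h4 := ((h3.mul h1).mul h2).const_mul (f j)
    rw [mul_inv_cancel₀ (eulerProd_ne_zero hq), one_mul] at h4
    simpa [tripleCoeff, sub_eq_add_neg] using h4
  · rw [norm_mul, tripleCoeff, norm_mul, norm_mul]
    gcongr
    exacts [hD _, hC _, hC _]

/-- The Jacobi triple product identity. -/
theorem tendsto_triple_product {q z : 𝕜} (hq0 : q ≠ 0) (hq : ‖q‖ < 1) (hz : z ≠ 0) :
    Tendsto (fun N => ∏ k ∈ Finset.range N,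
      ((1 - z * q ^ k) * (1 - q ^ (k + 1) / z) * (1 - q ^ (k + 1)))) atTop
      (𝓝 (∑' j, thetaTerm q z j)) := by
  have h := (tendsto_tsum_mul_tripleCoeff hq (f := thetaTerm q z)
    (by simpa using summable_abs_pow_mul_thetaTerm hq0 hq hz 0)).mul (tendsto_qPoch hq)
  rw [inv_mul_cancel_right₀ (eulerProd_ne_zero hq)] at h
  refine h.congr fun N => ?_
  rw [← finite_triple_product hq0 hq hz, qPoch, ← Finset.prod_mul_distrib]

/-- Jacobi's identity for the cube of the Euler product. -/
theorem tsum_mul_thetaTerm_one {q : 𝕜} (hq0 : q ≠ 0) (hq : ‖q‖ < 1) :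
    ∑' j : ℤ, (j : 𝕜) * thetaTerm q 1 j = -eulerProd q ^ 3 := by
  have key : ∀ N : ℕ, ∑' j : ℤ, (j : 𝕜) * thetaTerm q 1 j * tripleCoeff q (N + 1) j =
      -(qPoch q N * qPoch q (N + 1)) := by
    intro N
    -- The finite product with N + 1 factors contains 1 - z, and g is the rest. Differentiating at z
    -- = 1 leaves -g(1), for which continuity of g suffices.
    set g : 𝕜 → 𝕜 := fun z => (∏ k ∈ Finset.range N, (1 - z * q ^ (k + 1))) *
      ∏ k ∈ Finset.range (N + 1), (1 - q ^ (k + 1) / z)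
    have hg : ContinuousAt g 1 := by
      refine ContinuousAt.mul (by fun_prop) ?_
      refine tendsto_finsetProd _ fun k _ => ?_
      exact continuousAt_const.sub (continuousAt_const.div continuousAt_id one_ne_zero)
    have hg1 : g 1 = qPoch q N * qPoch q (N + 1) := by simp [g, qPoch]
    have h1 : HasDerivAt (fun z => (1 - z) * g z) (-g 1) 1 := by
      rw [hasDerivAt_iff_tendsto_slope]
      refine (hg.neg.tendsto.mono_left nhdsWithin_le_nhds).congr' ?_
      filter_upwards [self_mem_nhdsWithin] with z hz
      have : z - 1 ≠ 0 := sub_ne_zero.mpr hz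
      simp only [slope_def_field, sub_self, zero_mul, sub_zero, Pi.neg_apply]
      field_simp
      ring
    have h2 : HasDerivAt (fun z => ∑ j ∈ Finset.Icc (-(N + 1 : ℕ) : ℤ) (N + 1 : ℕ),
        thetaTerm q z j * tripleCoeff q (N + 1) j)
        (∑ j ∈ Finset.Icc (-(N + 1 : ℕ) : ℤ) (N + 1 : ℕ),
          (j : 𝕜) * thetaTerm q 1 j * tripleCoeff q (N + 1) j) 1 := by
      refine HasDerivAt.fun_sum fun j _ => ?_
      have h3 : HasDerivAt (fun z : 𝕜 => (-z) ^ j) ((j : 𝕜) * (-1) ^ (j - 1) * -1) 1 :=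
        HasDerivAt.comp (1 : 𝕜) (hasDerivAt_zpow j (-1 : 𝕜) (Or.inl (by norm_num)))
          (hasDerivAt_neg (1 : 𝕜))
      have h4 := (h3.mul_const (q ^ (j * (j - 1) / 2))).mul_const (tripleCoeff q (N + 1) j)
      refine h4.congr_deriv ?_
      rw [zpow_sub_one₀ (by norm_num)]
      simp only [thetaTerm]
      ring
    have h5 : (fun z => (1 - z) * g z) =ᶠ[𝓝 1] fun z => ∑ j ∈ Finset.Icc (-(N + 1 : ℕ) : ℤ)
        (N + 1 : ℕ), thetaTerm q z j * tripleCoeff q (N + 1) j := by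
      filter_upwards [isOpen_ne.mem_nhds (one_ne_zero : (1 : 𝕜) ≠ 0)] with z hz
      rw [← tsum_mul_tripleCoeff, ← finite_triple_product hq0 hq hz, Finset.prod_mul_distrib, Finset.prod_range_succ']
      simp only [g, pow_zero, mul_one]
      ring
    rw [tsum_mul_tripleCoeff, ← hg1]
    exact (h2.congr_of_eventuallyEq h5).unique h1
  have hs : Summable fun j : ℤ => ‖(j : 𝕜) * thetaTerm q 1 j‖ := by
    refine (summable_abs_pow_mul_thetaTerm hq0 hq (one_ne_zero : (1 : 𝕜) ≠ 0) 1).congr fun j => ?_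
    rw [norm_mul, pow_one, ← RCLike.ofReal_intCast (K := 𝕜), RCLike.norm_ofReal]
  have h1 := (tendsto_tsum_mul_tripleCoeff hq hs).comp (tendsto_add_atTop_nat 1)
  have h2 := ((tendsto_qPoch hq).mul ((tendsto_qPoch hq).comp (tendsto_add_atTop_nat 1))).neg
  have h3 := tendsto_nhds_unique h1 (h2.congr fun N => (key N).symm)
  have h0 := eulerProd_ne_zero hq
  field_simp at h3
  rw [h3]

end TripleProduct

/-! ### Schur's polynomials and their limits. -/

section Schur

variable {𝕜 : Type*} [RCLike 𝕜]

/-- The exponents of the Rogers-Ramanujan theta series. -/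
def rrExp (c j : ℤ) : ℤ := j * (5 * j + 1 + 2 * c) / 2

/-- The Rogers-Ramanujan theta series `∑ (-1)^j q^(j(5j+1+2c)/2)`; only `c = 0, 1` matter. -/
noncomputable def rrTheta (c : ℤ) (q : 𝕜) : 𝕜 := ∑' j : ℤ, (-1) ^ j * q ^ rrExp c j

lemma two_mul_rrExp (c j : ℤ) : 2 * rrExp c j = j * (5 * j + 1 + 2 * c) := by
  refine Int.mul_ediv_cancel' ?_
  rcases Int.even_or_odd' j with ⟨k, rfl | rfl⟩
  · exact ⟨k * (5 * (2 * k) + 1 + 2 * c), by ring⟩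
  · exact ⟨(2 * k + 1) * (5 * k + 3 + c), by ring⟩

lemma rrExp_succ (c j : ℤ) : rrExp c (j + 1) = rrExp c j + (5 * j + 3 + c) := by
  have h1 := two_mul_rrExp c j
  have h2 := two_mul_rrExp c (j + 1)
  have h3 : (j + 1) * (5 * (j + 1) + 1 + 2 * c) = j * (5 * j + 1 + 2 * c) + 2 * (5 * j + 3 + c) := by
    ring
  omega

lemma cast_rrExp (c j : ℤ) : (rrExp c j : ℝ) = 5 / 2 * (j : ℝ) ^ 2 + (1 + 2 * c) / 2 * j := by
  have h : (2 * rrExp c j : ℝ) = j * (5 * j + 1 + 2 * c) := by exact_mod_cast two_mul_rrExp c j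
  linear_combination h / 2

lemma summable_norm_rrTheta {q : 𝕜} (hq0 : q ≠ 0) (hq : ‖q‖ < 1) (c : ℤ) :
    Summable fun j : ℤ => ‖(-1) ^ j * q ^ rrExp c j‖ := by
  simpa using summable_abs_pow_mul_zpow hq0 hq (-1) (neg_ne_zero.mpr one_ne_zero) 0
    (by norm_num : (0 : ℝ) < 5 / 2) (cast_rrExp c)

/-- The Gaussian binomial coefficient, vanishing outside `0 ≤ k ≤ n`. -/
noncomputable def gaussBinom (q : 𝕜) (n : ℕ) (k : ℤ) : 𝕜 :=
  qPoch q n * qPochInv q k * qPochInv q (n - k)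

/-- The terms of Schur's polynomials. -/
noncomputable def schurTerm (c : ℤ) (q : 𝕜) (n : ℕ) (j : ℤ) : 𝕜 :=
  (-1) ^ j * q ^ rrExp c j * gaussBinom q n ((n - 5 * j - c) / 2)

/-- Schur's polynomials, which are the continuants of the Rogers-Ramanujan continued fraction. -/
noncomputable def schurPoly (c : ℤ) (q : 𝕜) (n : ℕ) : 𝕜 := ∑' j, schurTerm c q n j

/-- The telescoping defect in the recurrence for the terms of Schur's polynomials. -/
noncomputable def schurDefect (c : ℤ) (q : 𝕜) (n : ℕ) (j : ℤ) : 𝕜 :=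
  if Even (n - 5 * j - c) then
    (-1) ^ j * q ^ rrExp c j * (q ^ ((n + 2 - 5 * j - c) / 2) *
      gaussBinom q n ((n + 2 - 5 * j - c) / 2))
  else 0

lemma gaussBinom_of_neg (q : 𝕜) (n : ℕ) {k : ℤ} (hk : k < 0) : gaussBinom q n k = 0 := by
  rw [gaussBinom, qPochInv_of_neg q hk]; ring

lemma gaussBinom_of_lt (q : 𝕜) (n : ℕ) {k : ℤ} (hk : n < k) : gaussBinom q n k = 0 := by
  rw [gaussBinom, qPochInv_of_neg q (k := n - k) (by omega)]; ring

/-- Two q-Pascal steps, one of each kind. The next lemma is the mirror image; the parity of the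
index in `schurTerm` decides which one applies. -/
lemma gaussBinom_add_two_left {q : 𝕜} (hq0 : q ≠ 0) (hq : ‖q‖ < 1) (n : ℕ) (m : ℤ) :
    gaussBinom q (n + 2) m = gaussBinom q (n + 1) (m - 1) + q ^ (n + 1) * gaussBinom q n (m - 1) +
      q ^ m * gaussBinom q n m := by
  have h1 := qPochInv_sub_one hq m
  have h2 := qPochInv_sub_one hq (n + 2 - m)
  have h3 := qPochInv_sub_one hq (n + 1 - m)
  rw [show (n : ℤ) + 2 - m - 1 = n + 1 - m by ring] at h2
  rw [show (n : ℤ) + 1 - m - 1 = n - m by ring] at h3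
  have e1 : q ^ ((n : ℤ) + 2 - m) = q ^ n * q ^ 2 * (q ^ m)⁻¹ := by
    rw [zpow_sub₀ hq0, zpow_add₀ hq0, zpow_natCast, zpow_ofNat, div_eq_mul_inv]
  have e2 : q ^ ((n : ℤ) + 1 - m) = q ^ n * q * (q ^ m)⁻¹ := by
    rw [zpow_sub₀ hq0, zpow_add_one₀ hq0, zpow_natCast, div_eq_mul_inv]
  have hm : q ^ m ≠ 0 := zpow_ne_zero _ hq0
  simp only [gaussBinom]
  push_cast
  rw [show n + 2 = n + 1 + 1 by ring, qPoch_succ, qPoch_succ,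
    show (n : ℤ) + 1 - (m - 1) = n + 2 - m by ring, show (n : ℤ) - (m - 1) = n + 1 - m by ring,
    h3, h2, h1, e1, e2]
  field_simp
  ring

lemma gaussBinom_add_two_right {q : 𝕜} (hq0 : q ≠ 0) (hq : ‖q‖ < 1) (n : ℕ) (m : ℤ) :
    gaussBinom q (n + 2) m = gaussBinom q (n + 1) m + q ^ (n + 1) * gaussBinom q n (m - 1) +
      q ^ (n + 2 - m) * gaussBinom q n (m - 2) := by
  have h1 := qPochInv_sub_one hq m
  have h1' := qPochInv_sub_one hq (m - 1)
  have h2 := qPochInv_sub_one hq (n + 2 - m)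
  rw [show (n : ℤ) + 2 - m - 1 = n + 1 - m by ring] at h2
  rw [show (m : ℤ) - 1 - 1 = m - 2 by ring] at h1'
  have e1 : q ^ ((n : ℤ) + 2 - m) = q ^ n * q ^ 2 * (q ^ m)⁻¹ := by
    rw [zpow_sub₀ hq0, zpow_add₀ hq0, zpow_natCast, zpow_ofNat, div_eq_mul_inv]
  have e2 : q ^ (m - 1) = q ^ m * q⁻¹ := by rw [zpow_sub_one₀ hq0]
  have hm : q ^ m ≠ 0 := zpow_ne_zero _ hq0
  simp only [gaussBinom]
  push_cast
  rw [show n + 2 = n + 1 + 1 by ring, qPoch_succ, qPoch_succ,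
    show (n : ℤ) - (m - 1) = n + 1 - m by ring, show (n : ℤ) - (m - 2) = n + 2 - m by ring,
    h1', h2, h1, e1, e2]
  field_simp
  ring

lemma schurTerm_add_two {q : 𝕜} (hq0 : q ≠ 0) (hq : ‖q‖ < 1) (c : ℤ) (n : ℕ) (j : ℤ) :
    schurTerm c q (n + 2) j = schurTerm c q (n + 1) j + q ^ (n + 1) * schurTerm c q n j +
      (schurDefect c q n j - schurDefect c q n (j + 1)) := by
  simp only [schurTerm, schurDefect]
  push_cast
  -- The index of `schurTerm` is rounded down. In the even case the surplus term is the defect at j,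
  -- in the odd case it cancels the defect at j + 1; the other defect is zero.
  rcases Int.even_or_odd' (n + 2 - 5 * j - c) with ⟨m, hm | hm⟩
  · rw [if_pos ⟨m - 1, by omega⟩, if_neg (by rw [Int.not_even_iff_odd]; exact ⟨m - 4, by omega⟩),
      show ((n : ℤ) + 2 - 5 * j - c) / 2 = m by omega,
      show ((n : ℤ) + 1 - 5 * j - c) / 2 = m - 1 by omega,
      show ((n : ℤ) - 5 * j - c) / 2 = m - 1 by omega, gaussBinom_add_two_left hq0 hq]
    ring
  · rw [if_neg (by rw [Int.not_even_iff_odd]; exact ⟨m - 1, by omega⟩),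
      if_pos ⟨m - 3, by omega⟩,
      show ((n : ℤ) + 2 - 5 * j - c) / 2 = m by omega,
      show ((n : ℤ) + 1 - 5 * j - c) / 2 = m by omega,
      show ((n : ℤ) - 5 * j - c) / 2 = m - 1 by omega,
      show ((n : ℤ) + 2 - 5 * (j + 1) - c) / 2 = m - 2 by omega,
      gaussBinom_add_two_right hq0 hq, rrExp_succ, zpow_add_one₀ (by norm_num)]
    have e : q ^ (rrExp c j + (5 * j + 3 + c)) * q ^ (m - 2) =
        q ^ rrExp c j * q ^ ((n : ℤ) + 2 - m) := by
      rw [← zpow_add₀ hq0, ← zpow_add₀ hq0]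
      congr 1
      omega
    linear_combination (-1) ^ j * gaussBinom q n (m - 2) * (-e)

lemma schurTerm_eq_zero (c : ℤ) (q : 𝕜) (n : ℕ) {j : ℤ}
    (hj : j ∉ Finset.Icc (-(n + |c| + 1)) (n + |c| + 1)) : schurTerm c q n j = 0 := by
  rw [Finset.mem_Icc] at hj
  have h1 := le_abs_self c
  have h2 := neg_abs_le c
  unfold schurTerm
  by_cases h : ((n : ℤ) - 5 * j - c) / 2 < 0
  · rw [gaussBinom_of_neg q n h, mul_zero]
  · rw [gaussBinom_of_lt q n (by omega), mul_zero]

lemma schurDefect_eq_zero (c : ℤ) (q : 𝕜) (n : ℕ) {j : ℤ}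
    (hj : j ∉ Finset.Icc (-(n + |c| + 1)) (n + |c| + 1)) : schurDefect c q n j = 0 := by
  rw [Finset.mem_Icc] at hj
  have h1 := le_abs_self c
  have h2 := neg_abs_le c
  unfold schurDefect
  split_ifs with h0
  · by_cases h : ((n : ℤ) + 2 - 5 * j - c) / 2 < 0
    · rw [gaussBinom_of_neg q n h, mul_zero, mul_zero]
    · rw [gaussBinom_of_lt q n (by omega), mul_zero, mul_zero]
  · rfl

lemma summable_schurTerm (c : ℤ) (q : 𝕜) (n : ℕ) : Summable (schurTerm c q n) :=
  summable_of_ne_finset_zero fun _ => schurTerm_eq_zero c q n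

/-- Summing over j telescopes the defects away. What remains is the recurrence of the continuants,
with partial numerator q^{n+1}. -/
lemma schurPoly_add_two {q : 𝕜} (hq0 : q ≠ 0) (hq : ‖q‖ < 1) (c : ℤ) (n : ℕ) :
    schurPoly c q (n + 2) = schurPoly c q (n + 1) + q ^ (n + 1) * schurPoly c q n := by
  have hd : Summable (schurDefect c q n) :=
    summable_of_ne_finset_zero fun _ => schurDefect_eq_zero c q n
  have hd' : Summable fun j => schurDefect c q n (j + 1) :=
    hd.comp_injective (Equiv.addRight (1 : ℤ)).injective
  have e : ∑' j, schurDefect c q n (j + 1) = ∑' j, schurDefect c q n j :=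
    (Equiv.addRight (1 : ℤ)).tsum_eq _
  have s1 := summable_schurTerm c q (n + 1)
  have s0 := (summable_schurTerm c q n).mul_left (q ^ (n + 1))
  unfold schurPoly
  rw [tsum_congr fun j => schurTerm_add_two hq0 hq c n j, (s1.add s0).tsum_add (hd.sub hd'),
    s1.tsum_add s0, hd.tsum_sub hd', e, tsum_mul_left, sub_self, add_zero]

lemma gaussBinom_eq_zero (q : 𝕜) (n : ℕ) {k : ℤ} (hk : k < 0 ∨ n < k) : gaussBinom q n k = 0 :=
  hk.elim (gaussBinom_of_neg q n) (gaussBinom_of_lt q n)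

lemma gaussBinom_zero {q : 𝕜} (hq : ‖q‖ < 1) (n : ℕ) : gaussBinom q n 0 = 1 := by
  have h : ¬ ((n : ℤ) < 0) := by omega
  simp only [gaussBinom, qPochInv, lt_irrefl, if_false, Int.toNat_zero, sub_zero, h,
    Int.toNat_natCast]
  rw [show qPoch q 0 = 1 from Finset.prod_range_zero _, inv_one, mul_one,
    mul_inv_cancel₀ (qPoch_ne_zero hq n)]

lemma schurPoly_eq_one {q : 𝕜} (hq : ‖q‖ < 1) (c : ℤ) (n : ℕ) (h0 : (n - c) / 2 = 0)
    (h : ∀ j : ℤ, j ≠ 0 → (n - 5 * j - c) / 2 < 0 ∨ n < (n - 5 * j - c) / 2) :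
    schurPoly c q n = 1 := by
  rw [schurPoly, tsum_eq_single 0]
  · rw [schurTerm, show ((n : ℤ) - 5 * 0 - c) / 2 = 0 by simpa using h0, gaussBinom_zero hq,
      rrExp, zero_mul, Int.zero_ediv, zpow_zero, zpow_zero, mul_one, mul_one]
  · intro j hj
    rw [schurTerm, gaussBinom_eq_zero q n (h j hj), mul_zero]

lemma schurPoly_zero_zero {q : 𝕜} (hq : ‖q‖ < 1) : schurPoly 0 q 0 = 1 :=
  schurPoly_eq_one hq 0 0 (by norm_num) fun j hj => by push_cast; omega

lemma schurPoly_zero_one {q : 𝕜} (hq : ‖q‖ < 1) : schurPoly 0 q 1 = 1 :=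
  schurPoly_eq_one hq 0 1 (by norm_num) fun j hj => by push_cast; omega

lemma schurPoly_one_one {q : 𝕜} (hq : ‖q‖ < 1) : schurPoly 1 q 1 = 1 :=
  schurPoly_eq_one hq 1 1 (by norm_num) fun j hj => by push_cast; omega

/-- At j = 0 the index is ⌊-1/2⌋ = -1, so the corresponding term vanishes too. -/
lemma schurPoly_one_zero (q : 𝕜) : schurPoly 1 q 0 = 0 := by
  rw [schurPoly, tsum_congr (g := fun _ => 0), tsum_zero]
  intro j
  rw [schurTerm, gaussBinom_eq_zero q 0 (by push_cast; omega), mul_zero]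

/-- For fixed j both k and n - k tend to infinity, so the Gaussian binomial tends to 1/E(q). Its
uniform bound permits dominated convergence. -/
lemma tendsto_schurPoly {q : 𝕜} (hq0 : q ≠ 0) (hq : ‖q‖ < 1) (c : ℤ) :
    Tendsto (schurPoly c q) atTop (𝓝 (rrTheta c q * (eulerProd q)⁻¹)) := by
  obtain ⟨C, hC0, hC⟩ := exists_norm_qPochInv_le hq
  obtain ⟨D, hD0, hD⟩ := exists_norm_qPoch_le hq
  rw [rrTheta, ← tsum_mul_right]
  refine tendsto_tsum_of_dominated_convergence
    ((summable_norm_rrTheta hq0 hq c).mul_right (D * C * C)) (fun j => ?_)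
    (.of_forall fun n j => ?_)
  · have k1 : Tendsto (fun n : ℕ => ((n : ℤ) - 5 * j - c) / 2) atTop atTop :=
      tendsto_atTop.mpr fun b => (eventually_ge_atTop (2 * b + 5 * j + c).toNat).mono
        fun n hn => by omega
    have k2 : Tendsto (fun n : ℕ => (n : ℤ) - ((n : ℤ) - 5 * j - c) / 2) atTop atTop :=
      tendsto_atTop.mpr fun b => (eventually_ge_atTop (2 * b - 5 * j - c).toNat).mono
        fun n hn => by omega
    have h := (((tendsto_qPoch hq).mul (tendsto_qPochInv hq k1)).mul
      (tendsto_qPochInv hq k2)).const_mul ((-1) ^ j * q ^ rrExp c j)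
    rw [mul_inv_cancel₀ (eulerProd_ne_zero hq), one_mul] at h
    exact h
  · rw [schurTerm, gaussBinom, norm_mul _ (_ * _ * _), norm_mul (_ * _), norm_mul (qPoch q n)]
    gcongr
    exacts [hD _, hC _, hC _]

end Schur

/-! ### The convergents of the continued fraction. -/

section ContinuedFraction

lemma rrContFract_get (q : ℝ) (k : ℕ) :
    (rrContFract q).s.get? k = some ⟨if k = 0 then q ^ (1 / 5 : ℝ) else q ^ k, 1⟩ := rfl

lemma rrContFract_dens {q : ℝ} (hq0 : q ≠ 0) (hq : ‖q‖ < 1) (k : ℕ) :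
    (rrContFract q).dens k = schurPoly 0 q k ∧
      (rrContFract q).dens (k + 1) = schurPoly 0 q (k + 1) := by
  induction k with
  | zero =>
    rw [zero_add, schurPoly_zero_zero hq, schurPoly_zero_one hq]
    exact ⟨GenContFract.zeroth_den_eq_one, GenContFract.first_den_eq (rrContFract_get q 0)⟩
  | succ k ih =>
    refine ⟨ih.2, ?_⟩
    rw [GenContFract.dens_recurrence (rrContFract_get q (k + 1)) ih.1 ih.2,
      schurPoly_add_two hq0 hq]
    simp

lemma rrContFract_nums {q : ℝ} (hq0 : q ≠ 0) (hq : ‖q‖ < 1) (k : ℕ) :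
    (rrContFract q).nums k = q ^ (1 / 5 : ℝ) * schurPoly 1 q k ∧
      (rrContFract q).nums (k + 1) = q ^ (1 / 5 : ℝ) * schurPoly 1 q (k + 1) := by
  induction k with
  | zero =>
    rw [zero_add, schurPoly_one_zero, schurPoly_one_one hq, mul_zero, mul_one]
    refine ⟨GenContFract.zeroth_num_eq_h, ?_⟩
    rw [GenContFract.first_num_eq (rrContFract_get q 0)]
    simp [rrContFract]
  | succ k ih =>
    refine ⟨ih.2, ?_⟩
    rw [GenContFract.nums_recurrence (rrContFract_get q (k + 1)) ih.1 ih.2,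
      schurPoly_add_two hq0 hq]
    simp
    ring

/-- The Rogers-Ramanujan continued fraction as a quotient of theta series. -/
lemma rrR_eq_rrTheta_div {q : ℝ} (hq0 : 0 < q) (hq : q < 1) (h : rrTheta 0 q ≠ 0) :
    rrR q = q ^ (1 / 5 : ℝ) * (rrTheta 1 q / rrTheta 0 q) := by
  have hq' : ‖q‖ < 1 := by rwa [Real.norm_of_nonneg hq0.le]
  have hE := eulerProd_ne_zero hq'
  have h1 := ((tendsto_schurPoly hq0.ne' hq' 1).const_mul (q ^ (1 / 5 : ℝ))).div
    (tendsto_schurPoly hq0.ne' hq' 0) (mul_ne_zero h (inv_ne_zero hE))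
  refine Tendsto.limUnder_eq ?_
  convert h1 using 1
  · funext k
    simp only [GenContFract.convs, (rrContFract_nums hq0.ne' hq' k).1,
      (rrContFract_dens hq0.ne' hq' k).1, Pi.div_apply]
  · congr 1
    field_simp

end ContinuedFraction

/-! ### Product formulas and evaluations at fifth roots of unity. -/

section Products

variable {𝕜 : Type*} [RCLike 𝕜]

lemma norm_pow_lt_one {q : 𝕜} (hq : ‖q‖ < 1) {n : ℕ} (hn : n ≠ 0) : ‖q ^ n‖ < 1 := by
  rw [norm_pow]; exact pow_lt_one₀ (norm_nonneg _) hq hn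

lemma rrTheta_term_eq_thetaTerm {q : 𝕜} (hq0 : q ≠ 0) (c : ℕ) (j : ℤ) :
    thetaTerm (q ^ 5) (q ^ (3 + c)) j = (-1) ^ j * q ^ rrExp c j := by
  have h : rrExp c j = (3 + c) * j + 5 * (j * (j - 1) / 2) := by
    have h1 := two_mul_rrExp c j
    have h2 := Int.mul_ediv_cancel' (Int.even_mul_pred_self j).two_dvd
    linarith
  rw [thetaTerm, ← neg_one_mul, mul_zpow, h, zpow_add₀ hq0, zpow_mul, zpow_mul, mul_assoc]
  norm_cast

/-- The product formula for the Rogers-Ramanujan theta series. -/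
lemma tendsto_prod_rrTheta {q : 𝕜} (hq0 : q ≠ 0) (hq : ‖q‖ < 1) {c d : ℕ} (hcd : c + d = 1) :
    Tendsto (fun N => ∏ k ∈ Finset.range N, ((1 - q ^ (5 * k + 3 + c)) *
      (1 - q ^ (5 * k + 1 + d)) * (1 - q ^ (5 * k + 5)))) atTop (𝓝 (rrTheta c q)) := by
  have h := tendsto_triple_product (z := q ^ (3 + c)) (pow_ne_zero 5 hq0)
    (norm_pow_lt_one hq (by norm_num)) (pow_ne_zero _ hq0)
  rw [tsum_congr (rrTheta_term_eq_thetaTerm hq0 c)] at h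
  refine h.congr fun N => Finset.prod_congr rfl fun k _ => ?_
  have e : q ^ (5 * (k + 1)) / q ^ (3 + c) = q ^ (5 * k + 1 + d) := by
    rw [div_eq_iff (pow_ne_zero _ hq0), ← pow_add]
    congr 1
    omega
  rw [← pow_mul, ← pow_mul, e, ← pow_add, show 3 + c + 5 * k = 5 * k + 3 + c by ring,
    show 5 * (k + 1) = 5 * k + 5 by ring]

/-- The exponents in the two products are 2, 3 and 1, 4 modulo 5, and each product also contains all
multiples of 5; hence E(q), with one further copy of E(q^5). -/
lemma rrTheta_zero_mul_one {q : 𝕜} (hq0 : q ≠ 0) (hq : ‖q‖ < 1) :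
    rrTheta 0 q * rrTheta 1 q = eulerProd q * eulerProd (q ^ 5) := by
  have h0 := tendsto_prod_rrTheta hq0 hq (c := 0) (d := 1) rfl
  have h1 := tendsto_prod_rrTheta hq0 hq (c := 1) (d := 0) rfl
  have h2 := (((tendsto_qPoch hq).comp (tendsto_id.const_mul_atTop' (show 0 < 5 by norm_num))).mul
    (tendsto_qPoch (norm_pow_lt_one hq (show 5 ≠ 0 by norm_num))))
  refine tendsto_nhds_unique (h0.mul h1) (h2.congr fun N => ?_)
  induction N with
  | zero => simp [qPoch]
  | succ N ih =>
    rw [Finset.prod_range_succ, Finset.prod_range_succ, mul_mul_mul_comm, ← ih]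
    simp only [Function.comp_apply, id, show 5 * (N + 1) = 5 * N + 1 + 1 + 1 + 1 + 1 by ring,
      qPoch_succ]
    ring

lemma one_add_pows_eq_zero {w : 𝕜} (hw5 : w ^ 5 = 1) (hw : w ≠ 1) :
    1 + w + w ^ 2 + w ^ 3 + w ^ 4 = 0 := by
  have : (w - 1) * (1 + w + w ^ 2 + w ^ 3 + w ^ 4) = 0 := by linear_combination hw5
  exact (mul_eq_zero.mp this).resolve_left (sub_ne_zero.mpr hw)

/-- Inverse roots are paired, so that only w + w^4 and w^2 + w^3 occur; these have sum -1 and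
product -1. -/
lemma prod_add_fifth_root_mul {w : 𝕜} (hw5 : w ^ 5 = 1) (hw : w ≠ 1) (x z : 𝕜) :
    (x + z) * (x + w * z) * (x + w ^ 2 * z) * (x + w ^ 3 * z) * (x + w ^ 4 * z) =
      x ^ 5 + z ^ 5 := by
  have h := one_add_pows_eq_zero hw5 hw
  have h1 : (x + w * z) * (x + w ^ 4 * z) = x ^ 2 + (w + w ^ 4) * x * z + z ^ 2 := by
    linear_combination z ^ 2 * hw5
  have h2 : (x + w ^ 2 * z) * (x + w ^ 3 * z) = x ^ 2 + (-1 - (w + w ^ 4)) * x * z + z ^ 2 := by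
    linear_combination z ^ 2 * hw5 + x * z * h
  have h3 : (w + w ^ 4) * (-1 - (w + w ^ 4)) = -1 := by
    linear_combination -(2 + w ^ 3) * hw5 - h
  calc _ = (x + z) * ((x + w * z) * (x + w ^ 4 * z)) * ((x + w ^ 2 * z) * (x + w ^ 3 * z)) := by
        ring
    _ = _ := by
      rw [h1, h2]
      linear_combination (x + z) * x ^ 2 * z ^ 2 * h3

/-- The reflection j ↦ -1 - j fixes the exponent and flips the sign. -/
lemma tsum_neg_one_zpow_triangle_eq_zero (q : 𝕜) :
    ∑' j : ℤ, (-1) ^ j * q ^ ((j + 1) * j / 2) = 0 := by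
  have h := (Equiv.subLeft (-1 : ℤ)).tsum_eq fun j : ℤ => (-1 : 𝕜) ^ j * q ^ ((j + 1) * j / 2)
  have e : ∀ j : ℤ, (-1 : 𝕜) ^ (-1 - j) * q ^ ((-1 - j + 1) * (-1 - j) / 2) =
      -((-1) ^ j * q ^ ((j + 1) * j / 2)) := by
    intro j
    rw [show (-1 - j + 1) * (-1 - j) = (j + 1) * j by ring, zpow_sub₀ (by norm_num), zpow_neg_one,
      div_eq_mul_inv, ← inv_zpow, inv_neg_one]
    ring
  simp only [Equiv.subLeft_apply] at h
  rw [tsum_congr e, tsum_neg] at h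
  exact self_eq_neg.mp h.symm

lemma neg_fifth_root_zpow {w : 𝕜} (hw5 : w ^ 5 = 1) (j r : ℤ) :
    (-w) ^ (5 * j + r) = (-1) ^ j * (-w) ^ r := by
  have hw0 : w ≠ 0 := by rintro rfl; norm_num at hw5
  rw [zpow_add₀ (neg_ne_zero.mpr hw0), zpow_mul]
  congr 2
  rw [show (5 : ℤ) = (5 : ℕ) by rfl, zpow_natCast]
  linear_combination -hw5

/-- The 5-section of the theta series at a fifth root of unity. -/
lemma tsum_thetaTerm_fifth_root {s w : 𝕜} (hs0 : s ≠ 0) (hs : ‖s‖ < 1) (hw5 : w ^ 5 = 1) :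
    ∑' j, thetaTerm s w j =
      (1 - w) * rrTheta 0 (s ^ 5) + (w ^ 2 - w ^ 4) * s * rrTheta 1 (s ^ 5) := by
  have hw0 : w ≠ 0 := by rintro rfl; norm_num at hw5
  have hsum := summable_thetaTerm hs0 hs hw0
  have hq0 : s ^ 5 ≠ 0 := pow_ne_zero 5 hs0
  have hq : ‖s ^ 5‖ < 1 := norm_pow_lt_one hs (by norm_num)
  have t0 := (summable_norm_rrTheta hq0 hq 0).of_norm
  have t1 := (summable_norm_rrTheta hq0 hq 1).of_norm
  -- Here a is the power of s left over, and b the power of s^5. Residues 0, 1 will give `rrTheta 0`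
  -- and residues 2, 4 will give `rrTheta 1`.
  have hexp : ∀ j r a : ℤ, ∀ b : ℤ, (5 * j + r) * (5 * j + r - 1) = 2 * (a + 5 * b) →
      thetaTerm s w (5 * j + r) = (-1) ^ j * (s ^ 5) ^ b * ((-w) ^ r * s ^ a) := by
    intro j r a b h
    rw [thetaTerm, neg_fifth_root_zpow hw5, h, Int.mul_ediv_cancel_left _ two_ne_zero,
      zpow_add₀ hs0, zpow_mul, zpow_ofNat]
    ring
  have c0 : ∀ j : ℤ, thetaTerm s w (5 * j + 0) = (-1) ^ (-j) * (s ^ 5) ^ rrExp 0 (-j) := by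
    intro j
    rw [hexp j 0 0 (rrExp 0 (-j)) (by linear_combination -5 * two_mul_rrExp 0 (-j)), zpow_zero,
      zpow_zero, zpow_neg, ← inv_zpow, inv_neg_one]
    ring
  have c1 : ∀ j : ℤ, thetaTerm s w (5 * j + 1) = (-1) ^ j * (s ^ 5) ^ rrExp 0 j * -w := by
    intro j
    rw [hexp j 1 0 (rrExp 0 j) (by linear_combination -5 * two_mul_rrExp 0 j), zpow_zero, zpow_one]
    ring
  have c2 : ∀ j : ℤ, thetaTerm s w (5 * j + 2) =
      (-1) ^ j * (s ^ 5) ^ rrExp 1 j * (w ^ 2 * s) := by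
    intro j
    rw [hexp j 2 1 (rrExp 1 j) (by linear_combination -5 * two_mul_rrExp 1 j), zpow_ofNat, zpow_one]
    ring
  -- In this class the series is an alternating one over triangular numbers, in s^25, and sums to
  -- zero.
  have c3 : ∀ j : ℤ, thetaTerm s w (5 * j + 3) =
      (-1) ^ j * (s ^ 25) ^ ((j + 1) * j / 2) * ((-w) ^ 3 * s ^ 3) := by
    intro j
    have e : 2 * ((j + 1) * j / 2) = (j + 1) * j :=
      Int.mul_ediv_cancel' (by rw [mul_comm]; exact (Int.even_mul_succ_self j).two_dvd)
    rw [hexp j 3 3 (5 * ((j + 1) * j / 2)) (by linear_combination -25 * e), zpow_mul, zpow_ofNat,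
      zpow_ofNat, zpow_ofNat, ← pow_mul]
  have c4 : ∀ j : ℤ, thetaTerm s w (5 * j + 4) =
      (-1) ^ (-1 - j) * (s ^ 5) ^ rrExp 1 (-1 - j) * -(w ^ 4 * s) := by
    intro j
    rw [hexp j 4 1 (rrExp 1 (-1 - j)) (by linear_combination -5 * two_mul_rrExp 1 (-1 - j)),
      zpow_ofNat, zpow_one, zpow_sub₀ (by norm_num), zpow_neg_one, div_eq_mul_inv, ← inv_zpow,
      inv_neg_one]
    ring
  have hsub : ∀ r : ℤ, Summable fun j => thetaTerm s w (5 * j + r) := fun r =>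
    hsum.comp_injective fun a b h => by simpa using h
  have key : ∑' j, thetaTerm s w j = ∑' j, thetaTerm s w (5 * j + 0) +
      ∑' j, thetaTerm s w (5 * j + 1) + ∑' j, thetaTerm s w (5 * j + 2) +
      ∑' j, thetaTerm s w (5 * j + 3) + ∑' j, thetaTerm s w (5 * j + 4) := by
    have hp : Summable fun p : ℤ × Fin 5 => thetaTerm s w ((Int.divModEquiv 5).symm p) :=
      hsum.comp_injective (Int.divModEquiv 5).symm.injective
    rw [← (Int.divModEquiv 5).symm.tsum_eq, hp.tsum_prod,
      ← (hsub 0).tsum_add (hsub 1), ← ((hsub 0).add (hsub 1)).tsum_add (hsub 2),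
      ← (((hsub 0).add (hsub 1)).add (hsub 2)).tsum_add (hsub 3),
      ← ((((hsub 0).add (hsub 1)).add (hsub 2)).add (hsub 3)).tsum_add (hsub 4)]
    refine tsum_congr fun j => ?_
    rw [tsum_fintype, Fin.sum_univ_five]
    simp [Int.divModEquiv, mul_comm]
  have e0 : ∑' j : ℤ, (-1) ^ (-j) * (s ^ 5) ^ rrExp 0 (-j) = rrTheta 0 (s ^ 5) :=
    (Equiv.neg ℤ).tsum_eq fun j : ℤ => (-1) ^ j * (s ^ 5) ^ rrExp 0 j
  have e4 : ∑' j : ℤ, (-1) ^ (-1 - j) * (s ^ 5) ^ rrExp 1 (-1 - j) = rrTheta 1 (s ^ 5) :=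
    (Equiv.subLeft (-1 : ℤ)).tsum_eq fun j : ℤ => (-1) ^ j * (s ^ 5) ^ rrExp 1 j
  rw [key, tsum_congr c0, tsum_congr c1, tsum_congr c2, tsum_congr c3, tsum_congr c4,
    tsum_mul_right, tsum_mul_right, tsum_mul_right, tsum_mul_right,
    tsum_neg_one_zpow_triangle_eq_zero, e0, e4]
  simp only [rrTheta]
  ring

/-- The triple product at z = w divided by its factor 1 - w; note (w^2 - w^4)/(1 - w) = w^2 + w^3.
-/
lemma tendsto_prod_fifth_root {s w : 𝕜} (hs0 : s ≠ 0) (hs : ‖s‖ < 1) (hw5 : w ^ 5 = 1)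
    (hw : w ≠ 1) :
    Tendsto (fun N => ∏ k ∈ Finset.range N, ((1 - w * s ^ (k + 1)) * (1 - w ^ 4 * s ^ (k + 1)) *
      (1 - s ^ (k + 1)))) atTop
      (𝓝 (rrTheta 0 (s ^ 5) + (w ^ 2 + w ^ 3) * s * rrTheta 1 (s ^ 5))) := by
  have hw0 : w ≠ 0 := by rintro rfl; norm_num at hw5
  have hw1 : 1 - w ≠ 0 := sub_ne_zero.mpr hw.symm
  have h := tendsto_triple_product hs0 hs hw0
  rw [tsum_thetaTerm_fifth_root hs0 hs hw5] at h
  have h1 : Tendsto (fun N : ℕ => 1 - w * s ^ N) atTop (𝓝 (1 - w * 0)) :=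
    (tendsto_const_nhds.sub ((tendsto_pow_atTop_nhds_zero_of_norm_lt_one hs).const_mul w))
  have h2 := (h.mul h1).const_mul (1 - w)⁻¹
  have e : (1 - w)⁻¹ * (((1 - w) * rrTheta 0 (s ^ 5) + (w ^ 2 - w ^ 4) * s * rrTheta 1 (s ^ 5)) *
      (1 - w * 0)) = rrTheta 0 (s ^ 5) + (w ^ 2 + w ^ 3) * s * rrTheta 1 (s ^ 5) := by
    field_simp
    ring
  rw [e] at h2
  refine h2.congr fun N => ?_
  rw [inv_mul_eq_iff_eq_mul₀ hw1]
  have e2 : ∀ k : ℕ, s ^ (k + 1) / w = w ^ 4 * s ^ (k + 1) := fun k => by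
    rw [div_eq_iff hw0]; linear_combination -s ^ (k + 1) * hw5
  have e3 : (∏ k ∈ Finset.range N, (1 - w * s ^ k)) * (1 - w * s ^ N) =
      (1 - w) * ∏ k ∈ Finset.range N, (1 - w * s ^ (k + 1)) := by
    rw [← Finset.prod_range_succ, Finset.prod_range_succ', pow_zero, mul_one, mul_comm]
  simp only [e2, Finset.prod_mul_distrib]
  linear_combination (∏ k ∈ Finset.range N, (1 - w ^ 4 * s ^ (k + 1))) *
    (∏ k ∈ Finset.range N, (1 - s ^ (k + 1))) * e3

/-- The previous product is taken at w and at w^2. The four nontrivial roots then occur once each,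
and with one factor 1 - s^k they make 1 - s^{5k}. -/
lemma rrTheta_factor_mul_factor {s w : 𝕜} (hs0 : s ≠ 0) (hs : ‖s‖ < 1) (hw5 : w ^ 5 = 1)
    (hw : w ≠ 1) :
    (rrTheta 0 (s ^ 5) + (w ^ 2 + w ^ 3) * s * rrTheta 1 (s ^ 5)) *
      (rrTheta 0 (s ^ 5) + (w + w ^ 4) * s * rrTheta 1 (s ^ 5)) =
      eulerProd (s ^ 5) * eulerProd s := by
  have hw2 : w ^ 2 ≠ 1 := fun h => hw (by linear_combination hw5 - (w ^ 3 + w) * h)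
  have h1 := tendsto_prod_fifth_root hs0 hs hw5 hw
  have h2 := tendsto_prod_fifth_root (w := w ^ 2) hs0 hs
    (by linear_combination (w ^ 5 + 1) * hw5) hw2
  rw [show (w ^ 2) ^ 2 + (w ^ 2) ^ 3 = w + w ^ 4 by linear_combination w * hw5] at h2
  refine tendsto_nhds_unique (h1.mul h2) (((tendsto_qPoch (norm_pow_lt_one hs
    (show 5 ≠ 0 by norm_num))).mul (tendsto_qPoch hs)).congr fun N => ?_)
  rw [qPoch, qPoch, ← Finset.prod_mul_distrib, ← Finset.prod_mul_distrib]
  refine Finset.prod_congr rfl fun k _ => ?_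
  have h := prod_add_fifth_root_mul hw5 hw 1 (-s ^ (k + 1))
  have e : (w ^ 2) ^ 4 = w ^ 3 := by linear_combination w ^ 3 * hw5
  rw [e, ← pow_mul, mul_comm 5, pow_mul]
  linear_combination -(1 - s ^ (k + 1)) * h

/-- The factors with exponent m multiply to 1 - s^{5m} if 5 ∤ m, and to (1 - s^m)^5 otherwise. The
former give E(s^5)/E(s^25), the latter E(s^5)^5. -/
lemma prod_eulerProd_fifth_root_mul {s w : 𝕜} (hs : ‖s‖ < 1) (hw5 : w ^ 5 = 1)
    (hw : w ≠ 1) :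
    eulerProd s * eulerProd (w * s) * eulerProd (w ^ 2 * s) * eulerProd (w ^ 3 * s) *
      eulerProd (w ^ 4 * s) * eulerProd (s ^ 25) = eulerProd (s ^ 5) ^ 6 := by
  have hw1 : ‖w‖ = 1 := by
    have h : ‖w‖ ^ 5 = 1 := by rw [← norm_pow, hw5, norm_one]
    exact (pow_eq_one_iff_of_nonneg (norm_nonneg _) (by norm_num)).mp h
  have hn : ∀ i : ℕ, ‖w ^ i * s‖ < 1 := fun i => by
    rw [norm_mul, norm_pow, hw1, one_pow, one_mul]; exact hs
  have h5 : Tendsto (fun N : ℕ => 5 * N) atTop atTop :=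
    tendsto_id.const_mul_atTop' (show 0 < 5 by norm_num)
  have l := fun i => (tendsto_qPoch (hn i)).comp h5
  have r := (tendsto_qPoch (norm_pow_lt_one hs (show 5 ≠ 0 by norm_num)))
  have h1 := (((((l 0).mul (l 1)).mul (l 2)).mul (l 3)).mul (l 4)).mul
    (tendsto_qPoch (norm_pow_lt_one hs (show 25 ≠ 0 by norm_num)))
  have h2 := (r.comp h5).mul (r.pow 5)
  simp only [pow_zero, one_mul, pow_one, Function.comp_def] at h1
  rw [← pow_succ'] at h2
  refine tendsto_nhds_unique h1 (h2.congr fun N => ?_)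
  have pw : ∀ m : ℕ, m % 5 ≠ 0 → w ^ m ≠ 1 := by
    intro m hm h
    rw [← Nat.div_add_mod m 5, pow_add, pow_mul, hw5, one_pow, one_mul] at h
    have h' : m % 5 < 5 := Nat.mod_lt _ (by norm_num)
    have : m % 5 = 1 ∨ m % 5 = 2 ∨ m % 5 = 3 ∨ m % 5 = 4 := by omega
    rcases this with e | e | e | e <;> rw [e] at h
    · exact hw (by simpa using h)
    · exact hw (by linear_combination hw5 - (w ^ 3 + w) * h)
    · exact hw (by linear_combination h * (w ^ 3 + 1) - w * hw5)
    · exact hw (by linear_combination hw5 - w * h)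
  have pr : ∀ m : ℕ, m % 5 ≠ 0 → (1 - s ^ m) * (1 - (w * s) ^ m) * (1 - (w ^ 2 * s) ^ m) *
      (1 - (w ^ 3 * s) ^ m) * (1 - (w ^ 4 * s) ^ m) = 1 - (s ^ 5) ^ m := by
    intro m hm
    have h := prod_add_fifth_root_mul (w := w ^ m) (by rw [← pow_mul, mul_comm, pow_mul, hw5,
      one_pow]) (pw m hm) 1 (-s ^ m)
    have c : ∀ i, (w ^ i * s) ^ m = (w ^ m) ^ i * s ^ m := fun i => by
      rw [mul_pow, ← pow_mul, ← pow_mul, mul_comm i]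
    have h5 : (s ^ 5) ^ m = (s ^ m) ^ 5 := by rw [← pow_mul, ← pow_mul, mul_comm]
    rw [c, c, c, mul_pow, h5]
    linear_combination h
  have p0 : ∀ N : ℕ, ∀ i, (w ^ i * s) ^ (5 * N + 5) = (s ^ 5) ^ (N + 1) := fun N i => by
    rw [mul_pow, ← pow_mul, show i * (5 * N + 5) = 5 * (i * (N + 1)) by ring, pow_mul, hw5, one_pow,
      one_mul, ← pow_mul]
    rfl
  -- Each induction step adds a block of five consecutive exponents, the last being the multiple of
  -- 5.
  induction N with
  | zero => simp [qPoch]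
  | succ N ih =>
    simp only [Function.comp_apply, show 5 * (N + 1) = 5 * N + 4 + 1 by ring,
      show 5 * N + 4 = 5 * N + 3 + 1 by ring, show 5 * N + 3 = 5 * N + 2 + 1 by ring,
      show 5 * N + 2 = 5 * N + 1 + 1 by ring, qPoch_succ] at ih ⊢
    have a1 := pr (5 * N + 1) (by omega)
    have a2 := pr (5 * N + 1 + 1) (by omega)
    have a3 := pr (5 * N + 1 + 1 + 1) (by omega)
    have a4 := pr (5 * N + 1 + 1 + 1 + 1) (by omega)
    have b0 : s ^ (5 * N + 1 + 1 + 1 + 1 + 1) = (s ^ 5) ^ (N + 1) := by simpa using p0 N 0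
    have b1 : (w * s) ^ (5 * N + 1 + 1 + 1 + 1 + 1) = (s ^ 5) ^ (N + 1) := by simpa using p0 N 1
    have b2 := p0 N 2
    have b3 := p0 N 3
    have b4 := p0 N 4
    have b5 : (s ^ 25) ^ (N + 1) = (s ^ 5) ^ (5 * N + 1 + 1 + 1 + 1 + 1) := by
      rw [← pow_mul, ← pow_mul]; congr 1; ring
    simp only [show 5 * N + 5 = 5 * N + 1 + 1 + 1 + 1 + 1 by ring] at b2 b3 b4
    rw [b0, b1, b2, b3, b4, b5, ← a1, ← a2, ← a3, ← a4]
    generalize 1 - s ^ (5 * N + 1) = u00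
    generalize 1 - s ^ (5 * N + 1 + 1) = u01
    generalize 1 - s ^ (5 * N + 1 + 1 + 1) = u02
    generalize 1 - s ^ (5 * N + 1 + 1 + 1 + 1) = u03
    generalize 1 - (w * s) ^ (5 * N + 1) = u10
    generalize 1 - (w * s) ^ (5 * N + 1 + 1) = u11
    generalize 1 - (w * s) ^ (5 * N + 1 + 1 + 1) = u12
    generalize 1 - (w * s) ^ (5 * N + 1 + 1 + 1 + 1) = u13
    generalize 1 - (w ^ 2 * s) ^ (5 * N + 1) = u20
    generalize 1 - (w ^ 2 * s) ^ (5 * N + 1 + 1) = u21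
    generalize 1 - (w ^ 2 * s) ^ (5 * N + 1 + 1 + 1) = u22
    generalize 1 - (w ^ 2 * s) ^ (5 * N + 1 + 1 + 1 + 1) = u23
    generalize 1 - (w ^ 3 * s) ^ (5 * N + 1) = u30
    generalize 1 - (w ^ 3 * s) ^ (5 * N + 1 + 1) = u31
    generalize 1 - (w ^ 3 * s) ^ (5 * N + 1 + 1 + 1) = u32
    generalize 1 - (w ^ 3 * s) ^ (5 * N + 1 + 1 + 1 + 1) = u33
    generalize 1 - (w ^ 4 * s) ^ (5 * N + 1) = u40
    generalize 1 - (w ^ 4 * s) ^ (5 * N + 1 + 1) = u41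
    generalize 1 - (w ^ 4 * s) ^ (5 * N + 1 + 1 + 1) = u42
    generalize 1 - (w ^ 4 * s) ^ (5 * N + 1 + 1 + 1 + 1) = u43
    generalize 1 - (s ^ 5) ^ (N + 1) = v
    generalize 1 - (s ^ 5) ^ (5 * N + 1 + 1 + 1 + 1 + 1) = t
    linear_combination v ^ 5 * t * (u00 * u01 * u02 * u03 *
      u10 * u11 * u12 * u13 *
      u20 * u21 * u22 * u23 *
      u30 * u31 * u32 * u33 *
      u40 * u41 * u42 * u43) * ih

end Products

/-! ### The quintic relation. -/

section Quintic

lemma rrTheta_quintic_of_root {𝕜 : Type*} [RCLike 𝕜] {s w : 𝕜} (hs0 : s ≠ 0) (hs : ‖s‖ < 1)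
    (hw5 : w ^ 5 = 1) (hw : w ≠ 1) :
    (rrTheta 0 (s ^ 5) ^ 10 - 11 * s ^ 5 * rrTheta 0 (s ^ 5) ^ 5 * rrTheta 1 (s ^ 5) ^ 5 -
      (s ^ 5) ^ 2 * rrTheta 1 (s ^ 5) ^ 10) * eulerProd (s ^ 25) = eulerProd (s ^ 5) ^ 11 := by
  have hw0 : w ≠ 0 := by rintro rfl; norm_num at hw5
  have hw1 : ‖w‖ = 1 := by
    have h : ‖w‖ ^ 5 = 1 := by rw [← norm_pow, hw5, norm_one]
    exact (pow_eq_one_iff_of_nonneg (norm_nonneg _) (by norm_num)).mp h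
  -- Replacing s by w^i s leaves s^5, hence both theta values, unchanged. The product over i of
  -- these five relations gives the fifth powers.
  have F : ∀ i : ℕ, (rrTheta 0 (s ^ 5) + w ^ i * ((w ^ 2 + w ^ 3) * s * rrTheta 1 (s ^ 5))) *
      (rrTheta 0 (s ^ 5) + w ^ i * ((w + w ^ 4) * s * rrTheta 1 (s ^ 5))) =
      eulerProd (s ^ 5) * eulerProd (w ^ i * s) := by
    intro i
    have h := rrTheta_factor_mul_factor (s := w ^ i * s) (mul_ne_zero (pow_ne_zero _ hw0) hs0)
      (by rw [norm_mul, norm_pow, hw1, one_pow, one_mul]; exact hs) hw5 hw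
    have e : (w ^ i * s) ^ 5 = s ^ 5 := by
      rw [mul_pow, ← pow_mul, mul_comm i, pow_mul, hw5, one_pow, one_mul]
    rw [e] at h
    rw [← h]
    ring
  have a := prod_add_fifth_root_mul hw5 hw (rrTheta 0 (s ^ 5))
    ((w ^ 2 + w ^ 3) * s * rrTheta 1 (s ^ 5))
  have b := prod_add_fifth_root_mul hw5 hw (rrTheta 0 (s ^ 5))
    ((w + w ^ 4) * s * rrTheta 1 (s ^ 5))
  have h := one_add_pows_eq_zero hw5 hw
  have c1 : w ^ 2 + w ^ 3 = -1 - (w + w ^ 4) := by linear_combination h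
  have c2 : (w + w ^ 4) ^ 2 = 1 - (w + w ^ 4) := by linear_combination (2 + w ^ 3) * hw5 + h
  have P := prod_eulerProd_fifth_root_mul hs hw5 hw
  have F0 := F 0
  have F1 := F 1
  simp only [pow_zero, one_mul, pow_one] at F0 F1
  rw [c1] at a F0 F1
  have F2 := F 2
  have F3 := F 3
  have F4 := F 4
  rw [c1] at F2 F3 F4
  generalize w + w ^ 4 = c at *
  generalize rrTheta 0 (s ^ 5) = X at *
  generalize rrTheta 1 (s ^ 5) = Y at *
  have key : (X ^ 5 + ((-1 - c) * s * Y) ^ 5) * (X ^ 5 + (c * s * Y) ^ 5) =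
      eulerProd (s ^ 5) ^ 5 * (eulerProd s * eulerProd (w * s) * eulerProd (w ^ 2 * s) *
        eulerProd (w ^ 3 * s) * eulerProd (w ^ 4 * s)) := by
    rw [← a, ← b]
    calc _ = ((X + (-1 - c) * s * Y) * (X + c * s * Y)) *
          ((X + w * ((-1 - c) * s * Y)) * (X + w * (c * s * Y))) *
          ((X + w ^ 2 * ((-1 - c) * s * Y)) * (X + w ^ 2 * (c * s * Y))) *
          ((X + w ^ 3 * ((-1 - c) * s * Y)) * (X + w ^ 3 * (c * s * Y))) *
          ((X + w ^ 4 * ((-1 - c) * s * Y)) * (X + w ^ 4 * (c * s * Y))) := by ring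
      _ = _ := by rw [F0, F1, F2, F3, F4]; ring
  have d1 : (-1 - c) * c = -1 := by linear_combination -c2
  -- With c² = 1 - c, the numbers c and -1 - c are the roots of x² + x - 1, and the sum of their
  -- fifth powers is Ramanujan's -11.
  have d2 : (-1 - c) ^ 5 + c ^ 5 = -11 := by
    linear_combination (-5 * c ^ 2 - 5 * c - 10) * c2
  have d3 : ((-1 - c) * c) ^ 5 = -1 := by rw [d1]; norm_num
  calc _ = (X ^ 5 + ((-1 - c) * s * Y) ^ 5) * (X ^ 5 + (c * s * Y) ^ 5) * eulerProd (s ^ 25) := by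
        linear_combination (-s ^ 5 * X ^ 5 * Y ^ 5 * d2 - s ^ 10 * Y ^ 10 * d3) *
          eulerProd (s ^ 25)
    _ = _ := by rw [key]; linear_combination eulerProd (s ^ 5) ^ 5 * P

lemma ofReal_rrTheta (c : ℤ) (q : ℝ) : ((rrTheta c q : ℝ) : ℂ) = rrTheta c (q : ℂ) := by
  simp [rrTheta, Complex.ofReal_tsum]

lemma ofReal_eulerProd {q : ℝ} (hq : ‖q‖ < 1) : ((eulerProd q : ℝ) : ℂ) = eulerProd (q : ℂ) := by
  have h1 := (Complex.continuous_ofReal.tendsto _).comp (tendsto_qPoch hq)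
  have h2 := tendsto_qPoch (q := (q : ℂ)) (by rwa [Complex.norm_real])
  refine tendsto_nhds_unique h1 (h2.congr fun n => ?_)
  simp [qPoch]

/-- The quintic relation between the Rogers-Ramanujan theta series and the Euler product. -/
lemma rrTheta_quintic {q : ℝ} (hq0 : 0 < q) (hq : q < 1) :
    (rrTheta 0 q ^ 10 - 11 * q * rrTheta 0 q ^ 5 * rrTheta 1 q ^ 5 -
      q ^ 2 * rrTheta 1 q ^ 10) * eulerProd (q ^ 5) = eulerProd q ^ 11 := by
  set s : ℝ := q ^ (1 / 5 : ℝ) with hs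
  have hs5 : s ^ 5 = q := by
    rw [hs, ← Real.rpow_natCast, ← Real.rpow_mul hq0.le]; norm_num
  have hs0 : 0 < s := Real.rpow_pos_of_pos hq0 _
  have hs1 : s < 1 := Real.rpow_lt_one hq0.le hq (by norm_num)
  -- A primitive fifth root of unity exists only over ℂ, so the identity is proved there and cast
  -- back to ℝ.
  have hw := Complex.isPrimitiveRoot_exp 5 (by norm_num)
  have h := rrTheta_quintic_of_root (s := (s : ℂ)) (by exact_mod_cast hs0.ne')
    (by rwa [Complex.norm_real, Real.norm_of_nonneg hs0.le]) hw.pow_eq_one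
    (hw.ne_one (by norm_num))
  have e5 : (s : ℂ) ^ 5 = (q : ℂ) := by rw [← hs5]; push_cast; rfl
  have e25 : (s : ℂ) ^ 25 = ((q ^ 5 : ℝ) : ℂ) := by rw [← hs5]; push_cast; ring
  have n1 : ‖q‖ < 1 := by rwa [Real.norm_of_nonneg hq0.le]
  rw [e25, e5, ← ofReal_rrTheta, ← ofReal_rrTheta, ← ofReal_eulerProd n1,
    ← ofReal_eulerProd (norm_pow_lt_one n1 (by norm_num))] at h
  exact_mod_cast h

lemma eulerProd_pos {q : ℝ} (hq0 : 0 < q) (hq : q < 1) : 0 < eulerProd q := by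
  have n1 : ‖q‖ < 1 := by rwa [Real.norm_of_nonneg hq0.le]
  refine lt_of_le_of_ne (ge_of_tendsto' (tendsto_qPoch n1) fun n => ?_) (eulerProd_ne_zero n1).symm
  exact Finset.prod_nonneg fun i _ => sub_nonneg.mpr (pow_le_one₀ hq0.le hq.le)

/-- The products give nonnegativity; the formula for θ₀θ₁ excludes zero. -/
lemma rrTheta_pos {q : ℝ} (hq0 : 0 < q) (hq : q < 1) : 0 < rrTheta 0 q ∧ 0 < rrTheta 1 q := by
  have n1 : ‖q‖ < 1 := by rwa [Real.norm_of_nonneg hq0.le]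
  have nn : ∀ c d : ℕ, c + d = 1 → 0 ≤ rrTheta (c : ℤ) q := fun c d h =>
    ge_of_tendsto' (tendsto_prod_rrTheta hq0.ne' n1 h) fun n => Finset.prod_nonneg fun i _ =>
      mul_nonneg (mul_nonneg (sub_nonneg.mpr (pow_le_one₀ hq0.le hq.le))
        (sub_nonneg.mpr (pow_le_one₀ hq0.le hq.le))) (sub_nonneg.mpr (pow_le_one₀ hq0.le hq.le))
  have h0 : 0 ≤ rrTheta 0 q := nn 0 1 rfl
  have h1 : 0 ≤ rrTheta 1 q := nn 1 0 rfl
  have h : 0 < rrTheta 0 q * rrTheta 1 q := by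
    rw [rrTheta_zero_mul_one hq0.ne' n1]
    exact mul_pos (eulerProd_pos hq0 hq) (eulerProd_pos (by positivity)
      (pow_lt_one₀ hq0.le hq (by norm_num)))
  exact ⟨lt_of_le_of_ne h0 (by rintro e; simp [← e] at h),
    lt_of_le_of_ne h1 (by rintro e; simp [← e] at h)⟩

lemma rrR_eq {q : ℝ} (hq0 : 0 < q) (hq : q < 1) :
    rrR q = q ^ (1 / 5 : ℝ) * (rrTheta 1 q / rrTheta 0 q) :=
  rrR_eq_rrTheta_div hq0 hq (rrTheta_pos hq0 hq).1.ne'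

lemma rrR_pos {q : ℝ} (hq0 : 0 < q) (hq : q < 1) : 0 < rrR q := by
  rw [rrR_eq hq0 hq]
  exact mul_pos (Real.rpow_pos_of_pos hq0 _) (div_pos (rrTheta_pos hq0 hq).2 (rrTheta_pos hq0 hq).1)

/-- Ramanujan's identity `R^(-5) - 11 - R^5 = f(-q)^6 / (q f(-q^5)^6)`. -/
lemma rrR_quintic {q : ℝ} (hq0 : 0 < q) (hq : q < 1) :
    (rrR q ^ 5)⁻¹ - 11 - rrR q ^ 5 = eulerProd q ^ 6 / (q * eulerProd (q ^ 5) ^ 6) := by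
  have n1 : ‖q‖ < 1 := by rwa [Real.norm_of_nonneg hq0.le]
  obtain ⟨p0, p1⟩ := rrTheta_pos hq0 hq
  have hE := eulerProd_pos hq0 hq
  have hE5 := eulerProd_pos (q := q ^ 5) (by positivity) (pow_lt_one₀ hq0.le hq (by norm_num))
  have hR : rrR q ^ 5 = q * (rrTheta 1 q / rrTheta 0 q) ^ 5 := by
    rw [rrR_eq hq0 hq, mul_pow, ← Real.rpow_natCast, ← Real.rpow_mul hq0.le]
    norm_num
  have h1 := rrTheta_quintic hq0 hq
  have h2 := rrTheta_zero_mul_one hq0.ne' n1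
  have h3 : (rrTheta 0 q * rrTheta 1 q) ^ 5 = (eulerProd q * eulerProd (q ^ 5)) ^ 5 := by rw [h2]
  have h4 : (rrR q ^ 5)⁻¹ - 11 - rrR q ^ 5 =
      (rrTheta 0 q ^ 10 - 11 * q * rrTheta 0 q ^ 5 * rrTheta 1 q ^ 5 -
      q ^ 2 * rrTheta 1 q ^ 10) / (q * (rrTheta 0 q * rrTheta 1 q) ^ 5) := by
    rw [hR]; field_simp
  rw [h4, h3, div_eq_div_iff (by positivity) (by positivity)]
  linear_combination q * eulerProd (q ^ 5) ^ 5 * h1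

end Quintic

/-! ### The Wronskian of the theta series via Gaussian integers. -/

section Wronskian

/-- The odd character modulo 4, with real values. -/
noncomputable def oddSign (u : ℤ) : ℝ := ((ZMod.χ₄ (u : ZMod 4) : ℤ) : ℝ)

/-- The terms `χ₄(u) u^k exp(-u²y)` of the weighted odd theta series. -/
noncomputable def oddTerm (k : ℕ) (y : ℝ) (u : ℤ) : ℝ :=
  oddSign u * (u : ℝ) ^ k * Real.exp (-(u : ℝ) ^ 2 * y)

/-- The terms of the Wronskian of two odd theta series. -/
noncomputable def wronskiTerm (y : ℝ) (p : ℤ × ℤ) : ℝ :=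
  oddTerm 0 y p.1 * oddTerm 2 y p.2 - oddTerm 2 y p.1 * oddTerm 0 y p.2

lemma abs_oddSign_le (u : ℤ) : |oddSign u| ≤ 1 := by
  unfold oddSign
  have h : ∀ a : ZMod 4, |ZMod.χ₄ a| ≤ 1 := by decide
  exact_mod_cast h u

lemma oddSign_even (j : ℤ) : oddSign (2 * j) = 0 := by
  unfold oddSign
  have h : ∀ a : ZMod 4, ZMod.χ₄ (2 * a) = 0 := by decide
  push_cast
  rw [h]
  simp

lemma oddSign_neg (u : ℤ) : oddSign (-u) = -oddSign u := by
  unfold oddSign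
  have h : ∀ a : ZMod 4, ZMod.χ₄ (-a) = -ZMod.χ₄ a := by decide
  push_cast
  rw [h]
  simp

lemma oddSign_add_two (u : ℤ) : oddSign (u + 2) = -oddSign u := by
  unfold oddSign
  have h : ∀ a : ZMod 4, ZMod.χ₄ (a + 2) = -ZMod.χ₄ a := by decide
  push_cast
  rw [h]
  simp

lemma oddSign_one_add_two_mul (j : ℤ) : oddSign (2 * j + 1) = (-1) ^ j := by
  have h1 : oddSign 1 = 1 := by
    unfold oddSign
    have h : ZMod.χ₄ (1 : ZMod 4) = 1 := by decide
    rw [Int.cast_one, h, Int.cast_one]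
  induction j with
  | zero => simpa using h1
  | succ i ih =>
    rw [show (2 * ((i : ℤ) + 1) + 1) = 2 * i + 1 + 2 by ring, oddSign_add_two, ih,
      zpow_add_one₀ (by norm_num)]
    ring
  | pred i ih =>
    have h := oddSign_add_two (2 * (-(i : ℤ) - 1) + 1)
    rw [show 2 * (-(i : ℤ) - 1) + 1 + 2 = 2 * -i + 1 by ring, ih] at h
    rw [zpow_sub_one₀ (by norm_num), h]
    norm_num

lemma oddSign_mul_rotate (x y : ℤ) :
    oddSign (x - 2 * y) * oddSign (2 * x + y) = oddSign x * oddSign y := by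
  unfold oddSign
  have h : ∀ a b : ZMod 4, ZMod.χ₄ (a - 2 * b) * ZMod.χ₄ (2 * a + b) = ZMod.χ₄ a * ZMod.χ₄ b := by
    decide
  push_cast
  rw [← Int.cast_mul, h, Int.cast_mul]

lemma summable_abs_pow_mul_exp {y : ℝ} (hy : 0 < y) (k : ℕ) :
    Summable fun u : ℤ => |(u : ℝ)| ^ k * Real.exp (-(u : ℝ) ^ 2 * y) := by
  refine (summable_pow_mul_jacobiTheta₂_term_bound 0 (div_pos hy Real.pi_pos) k).congr fun u => ?_
  push_cast
  congr 2
  field_simp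
  ring

lemma norm_oddTerm_le (k : ℕ) (y : ℝ) (u : ℤ) :
    ‖oddTerm k y u‖ ≤ |(u : ℝ)| ^ k * Real.exp (-(u : ℝ) ^ 2 * y) := by
  rw [oddTerm, norm_mul, norm_mul, norm_pow, Real.norm_of_nonneg (Real.exp_pos _).le,
    Real.norm_eq_abs, Real.norm_eq_abs]
  gcongr
  exact mul_le_of_le_one_left (by positivity) (abs_oddSign_le u)

lemma summable_norm_oddTerm {y : ℝ} (hy : 0 < y) (k : ℕ) : Summable fun u => ‖oddTerm k y u‖ :=
  Summable.of_nonneg_of_le (fun _ => norm_nonneg _) (norm_oddTerm_le k y)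
    (summable_abs_pow_mul_exp hy k)

lemma summable_wronskiTerm {y : ℝ} (hy : 0 < y) : Summable (wronskiTerm y) :=
  (summable_mul_of_summable_norm (summable_norm_oddTerm hy 0) (summable_norm_oddTerm hy 2)).sub
    (summable_mul_of_summable_norm (summable_norm_oddTerm hy 2) (summable_norm_oddTerm hy 0))

lemma wronskiTerm_swap (y : ℝ) (p : ℤ × ℤ) : wronskiTerm y p.swap = -wronskiTerm y p := by
  simp only [wronskiTerm, Prod.fst_swap, Prod.snd_swap]
  ring

lemma oddTerm_neg (k : ℕ) (y : ℝ) (u : ℤ) : oddTerm k y (-u) = (-1) ^ (k + 1) * oddTerm k y u := by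
  simp only [oddTerm, oddSign_neg]
  push_cast
  rw [neg_pow (u : ℝ) k, neg_sq]
  ring

/-- Invariance under multiplication by i on u + iv: the signs from the odd character and from v² -
u² cancel. -/
lemma wronskiTerm_rotate (y : ℝ) (u v : ℤ) : wronskiTerm y (-v, u) = wronskiTerm y (u, v) := by
  simp only [wronskiTerm, oddTerm_neg]
  ring

lemma wronskiTerm_eq (y : ℝ) (u v : ℤ) : wronskiTerm y (u, v) =
    oddSign u * oddSign v * ((v : ℝ) ^ 2 - (u : ℝ) ^ 2) *
      Real.exp (-((u : ℝ) ^ 2 + (v : ℝ) ^ 2) * y) := by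
  simp only [wronskiTerm, oddTerm]
  rw [show -((u : ℝ) ^ 2 + (v : ℝ) ^ 2) * y = -(u : ℝ) ^ 2 * y + -(v : ℝ) ^ 2 * y by ring,
    Real.exp_add]
  ring

/-- Multiplication by `1 + 2i` on the Gaussian integers. -/
lemma wronskiTerm_one_add_two_I (y : ℝ) (a b : ℤ) : wronskiTerm y (a - 2 * b, 2 * a + b) =
    8 * (oddTerm 1 (5 * y) a * oddTerm 1 (5 * y) b) - 3 * wronskiTerm (5 * y) (a, b) := by
  rw [wronskiTerm_eq, wronskiTerm_eq, oddSign_mul_rotate]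
  have e : oddTerm 1 (5 * y) a * oddTerm 1 (5 * y) b = oddSign a * oddSign b * (a * b) *
      Real.exp (-((a : ℝ) ^ 2 + (b : ℝ) ^ 2) * (5 * y)) := by
    simp only [oddTerm]
    rw [show -((a : ℝ) ^ 2 + (b : ℝ) ^ 2) * (5 * y) =
      -(a : ℝ) ^ 2 * (5 * y) + -(b : ℝ) ^ 2 * (5 * y) by ring, Real.exp_add]
    ring
  rw [e]
  push_cast
  rw [show -(((a : ℝ) - 2 * b) ^ 2 + (2 * a + b) ^ 2) * y =
    -((a : ℝ) ^ 2 + (b : ℝ) ^ 2) * (5 * y) by ring]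
  ring

/-- A residue class modulo 5 in the lattice `v ≡ 2u`. -/
def residueLine (r : ℤ) : Set (ℤ × ℤ) := {p | p.1 % 5 = r % 5 ∧ p.2 % 5 = (2 * r) % 5}

/-- Multiplication by i carries the class r to 3r, and 3 generates the units modulo 5, so all four
nonzero classes have the same sum. -/
lemma tsum_indicator_residueLine_rotate (y : ℝ) (r : ℤ) :
    ∑' p, (residueLine (3 * r)).indicator (wronskiTerm y) p =
      ∑' p, (residueLine r).indicator (wronskiTerm y) p := by
  let e : ℤ × ℤ ≃ ℤ × ℤ :=
    { toFun := fun p => (-p.2, p.1)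
      invFun := fun p => (p.2, -p.1)
      left_inv := fun p => by simp
      right_inv := fun p => by simp }
  rw [← e.tsum_eq]
  refine tsum_congr fun p => ?_
  have h : e p ∈ residueLine (3 * r) ↔ p ∈ residueLine r := by
    simp only [residueLine, mem_ofPred_eq, e, Equiv.coe_fn_mk]
    omega
  by_cases hp : p ∈ residueLine r
  · rw [indicator_of_mem hp, indicator_of_mem (h.mpr hp)]
    exact wronskiTerm_rotate y p.1 p.2
  · rw [indicator_of_notMem hp, indicator_of_notMem (mt h.mp hp)]

lemma tsum_eq_zero_of_swap {f : ℤ × ℤ → ℝ} (hf : ∀ p, f p.swap = -f p) : ∑' p, f p = 0 := by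
  have h := (Equiv.prodComm ℤ ℤ).tsum_eq f
  simp only [Equiv.prodComm_apply] at h
  rw [tsum_congr hf, tsum_neg] at h
  exact self_eq_neg.mp h.symm

lemma tsum_indicator_residueLine_zero (y : ℝ) :
    ∑' p, (residueLine 0).indicator (wronskiTerm y) p = 0 := by
  refine tsum_eq_zero_of_swap fun p => ?_
  have h : p.swap ∈ residueLine 0 ↔ p ∈ residueLine 0 := by
    simp only [residueLine, mem_ofPred_eq, Prod.fst_swap, Prod.snd_swap]
    omega
  by_cases hp : p ∈ residueLine 0
  · rw [indicator_of_mem hp, indicator_of_mem (h.mpr hp), wronskiTerm_swap]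
  · rw [indicator_of_notMem hp, indicator_of_notMem (mt h.mp hp), neg_zero]

/-- The multiples of `1 + 2i` in the Gaussian integers. -/
def residueLattice : Set (ℤ × ℤ) := {p | p.2 % 5 = (2 * p.1) % 5}

lemma indicator_residueLattice (f : ℤ × ℤ → ℝ) (p : ℤ × ℤ) :
    residueLattice.indicator f p = (residueLine 0).indicator f p +
      (residueLine 1).indicator f p + (residueLine 2).indicator f p +
      (residueLine 3).indicator f p + (residueLine 4).indicator f p := by
  classical
  simp only [indicator_apply, residueLattice, residueLine, mem_ofPred_eq]
  have h : p.1 % 5 = 0 ∨ p.1 % 5 = 1 ∨ p.1 % 5 = 2 ∨ p.1 % 5 = 3 ∨ p.1 % 5 = 4 := by omega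
  by_cases hp : p.2 % 5 = (2 * p.1) % 5
  · rw [if_pos hp]
    rcases h with h | h | h | h | h <;>
      · have h2 : p.2 % 5 = (2 * (p.1 % 5)) % 5 := by omega
        rw [h] at h2
        simp [h, h2]
  · rw [if_neg hp]
    rcases h with h | h | h | h | h <;>
      · have h2 : p.2 % 5 ≠ (2 * (p.1 % 5)) % 5 := by omega
        rw [h] at h2
        norm_num at h2
        simp [h, h2]

lemma tsum_indicator_residueLattice {y : ℝ} (hy : 0 < y) :
    ∑' p, residueLattice.indicator (wronskiTerm y) p =
      4 * ∑' p, (residueLine 1).indicator (wronskiTerm y) p := by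
  have hs : ∀ r, Summable ((residueLine r).indicator (wronskiTerm y)) := fun r =>
    (summable_wronskiTerm hy).indicator _
  rw [tsum_congr (indicator_residueLattice _),
    ((((hs 0).add (hs 1)).add (hs 2)).add (hs 3)).tsum_add (hs 4),
    (((hs 0).add (hs 1)).add (hs 2)).tsum_add (hs 3),
    ((hs 0).add (hs 1)).tsum_add (hs 2), (hs 0).tsum_add (hs 1),
    tsum_indicator_residueLine_zero]
  have r1 := tsum_indicator_residueLine_rotate y 1
  have r3 := tsum_indicator_residueLine_rotate y 3
  have r4 := tsum_indicator_residueLine_rotate y 4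
  have e9 : residueLine (3 * 3) = residueLine 4 := by simp [residueLine]
  have e12 : residueLine (3 * 4) = residueLine 2 := by simp [residueLine]
  rw [e9] at r3
  rw [e12] at r4
  rw [mul_one] at r1
  rw [r4, r3, r1]
  ring

lemma tsum_indicator_residueLattice_eq (f : ℤ × ℤ → ℝ) :
    ∑' p, residueLattice.indicator f p = ∑' p : ℤ × ℤ, f (p.1 - 2 * p.2, 2 * p.1 + p.2) := by
  let g : ℤ × ℤ → ℤ × ℤ := fun p => (p.1 - 2 * p.2, 2 * p.1 + p.2)
  have hg : Function.Injective g := by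
    rintro ⟨a, b⟩ ⟨c, d⟩ h
    simp only [g, Prod.mk.injEq] at h ⊢
    omega
  rw [← hg.tsum_eq (f := residueLattice.indicator f)]
  · refine tsum_congr fun p => indicator_of_mem ?_ _
    simp only [residueLattice, g, mem_ofPred_eq]
    omega
  · intro p hp
    have hp' : p ∈ residueLattice := by
      by_contra h
      exact hp (indicator_of_notMem h _)
    simp only [residueLattice, mem_ofPred_eq] at hp'
    refine ⟨((p.1 + 2 * p.2) / 5, (p.2 - 2 * p.1) / 5), ?_⟩
    ext <;> simp only [g] <;> omega

/-- The four equal classes fill the multiples of 1 + 2i up to the class 0, which sums to zero by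
antisymmetry. Dividing by 1 + 2i turns v² - u² into 8ab - 3(b² - a²), whose second part is again
antisymmetric. -/
lemma four_mul_tsum_residueLine {y : ℝ} (hy : 0 < y) :
    4 * ∑' p, (residueLine 1).indicator (wronskiTerm y) p =
      8 * (∑' u, oddTerm 1 (5 * y) u) ^ 2 := by
  have h5 : 0 < 5 * y := by linarith
  have hsw : ∑' p, wronskiTerm (5 * y) p = 0 := tsum_eq_zero_of_swap (wronskiTerm_swap _)
  have hC := summable_norm_oddTerm h5 1
  have hp : Summable fun p : ℤ × ℤ => oddTerm 1 (5 * y) p.1 * oddTerm 1 (5 * y) p.2 :=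
    summable_mul_of_summable_norm hC hC
  have e1 : ∑' p : ℤ × ℤ, wronskiTerm y (p.1 - 2 * p.2, 2 * p.1 + p.2) =
      ∑' p : ℤ × ℤ, (8 * (oddTerm 1 (5 * y) p.1 * oddTerm 1 (5 * y) p.2) -
        3 * wronskiTerm (5 * y) p) :=
    tsum_congr fun p => wronskiTerm_one_add_two_I y p.1 p.2
  have e2 : (∑' u, oddTerm 1 (5 * y) u) * (∑' u, oddTerm 1 (5 * y) u) =
      ∑' p : ℤ × ℤ, oddTerm 1 (5 * y) p.1 * oddTerm 1 (5 * y) p.2 :=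
    tsum_mul_tsum_of_summable_norm hC hC
  rw [← tsum_indicator_residueLattice hy, tsum_indicator_residueLattice_eq, sq, e1, e2,
    (hp.mul_left 8).tsum_sub ((summable_wronskiTerm h5).mul_left 3), tsum_mul_left, tsum_mul_left,
    hsw, mul_zero, sub_zero]

/-- The odd theta series along an arithmetic progression `10 j + r`. -/
noncomputable def oddTheta (r : ℤ) (k : ℕ) (y : ℝ) : ℝ := ∑' j : ℤ, oddTerm k y (10 * j + r)

lemma oddTheta_injective (r : ℤ) : Function.Injective fun j : ℤ => 10 * j + r :=
  fun a b h => by simpa using h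

lemma summable_norm_oddTerm_progression {y : ℝ} (hy : 0 < y) (r : ℤ) (k : ℕ) :
    Summable fun j : ℤ => ‖oddTerm k y (10 * j + r)‖ :=
  (summable_norm_oddTerm hy k).comp_injective (oddTheta_injective r)

lemma hasDerivAt_oddTheta {y : ℝ} (hy : 0 < y) (r : ℤ) :
    HasDerivAt (oddTheta r 0) (-oddTheta r 2 y) y := by
  have hy2 : 0 < y / 2 := half_pos hy
  -- The values at y/2 dominate the termwise derivatives on x > y/2.
  have hb : Summable fun j : ℤ => |((10 * j + r : ℤ) : ℝ)| ^ 2 *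
      Real.exp (-((10 * j + r : ℤ) : ℝ) ^ 2 * (y / 2)) :=
    (summable_abs_pow_mul_exp hy2 2).comp_injective (oddTheta_injective r)
  have hterm : ∀ (u : ℤ) (x : ℝ), HasDerivAt (fun x => oddTerm 0 x u) (-oddTerm 2 x u) x := by
    intro u x
    have h1 : HasDerivAt (fun x : ℝ => -(u : ℝ) ^ 2 * x) (-(u : ℝ) ^ 2) x := by
      simpa using (hasDerivAt_id x).const_mul (-(u : ℝ) ^ 2)
    refine (h1.exp.const_mul (oddSign u * (u : ℝ) ^ 0)).congr_deriv ?_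
    simp only [oddTerm]
    ring
  have h := hasDerivAt_tsum_of_isPreconnected (𝕜 := ℝ) hb (isOpen_Ioi (a := y / 2))
    isPreconnected_Ioi
    (g := fun j x => oddTerm 0 x (10 * j + r)) (g' := fun j x => -oddTerm 2 x (10 * j + r))
    (fun j x _ => hterm _ x) (fun j x hx => ?_) (y₀ := y) (half_lt_self hy)
    (summable_norm_oddTerm_progression hy r 0).of_norm (half_lt_self hy)
  · rw [tsum_neg] at h
    exact h
  · rw [norm_neg]
    refine (norm_oddTerm_le 2 x _).trans ?_
    have hx' : y / 2 ≤ x := le_of_lt hx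
    refine mul_le_mul_of_nonneg_left (Real.exp_le_exp.mpr ?_) (by positivity)
    nlinarith [sq_nonneg ((10 * j + r : ℤ) : ℝ)]

lemma oddTheta_wronskian {y : ℝ} (hy : 0 < y) :
    oddTheta 1 0 y * oddTheta 7 2 y - oddTheta 1 2 y * oddTheta 7 0 y =
      ∑' p, (residueLine 1).indicator (wronskiTerm y) p := by
  have s := summable_norm_oddTerm_progression hy
  let g : ℤ × ℤ → ℤ × ℤ := fun p => (10 * p.1 + 1, 10 * p.2 + 7)
  have hg : Function.Injective g := by
    rintro ⟨a, b⟩ ⟨c, d⟩ h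
    simp only [g, Prod.mk.injEq] at h ⊢
    omega
  simp only [oddTheta]
  rw [tsum_mul_tsum_of_summable_norm (s 1 0) (s 7 2), tsum_mul_tsum_of_summable_norm (s 1 2) (s 7 0),
    ← (summable_mul_of_summable_norm (s 1 0) (s 7 2)).tsum_sub
      (summable_mul_of_summable_norm (s 1 2) (s 7 0)),
    ← hg.tsum_eq (f := (residueLine 1).indicator (wronskiTerm y))]
  · refine tsum_congr fun p => ?_
    rw [indicator_of_mem]
    · rfl
    · simp only [residueLine, g, mem_ofPred_eq]
      omega
  · intro p hp
    have hp1 : p ∈ residueLine 1 := by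
      by_contra h
      exact hp (indicator_of_notMem h _)
    have hp2 : wronskiTerm y p ≠ 0 := by
      intro h
      exact hp (by rw [indicator_of_mem hp1, h])
    simp only [residueLine, mem_ofPred_eq] at hp1
    -- The character kills even entries, so the residues 1, 2 modulo 5 become 1, 7 modulo 10.
    have o1 : p.1 % 2 = 1 := by
      by_contra h
      obtain ⟨m, hm⟩ : ∃ m, p.1 = 2 * m := ⟨p.1 / 2, by omega⟩
      exact hp2 (by simp [wronskiTerm, oddTerm, hm, oddSign_even])
    have o2 : p.2 % 2 = 1 := by
      by_contra h
      obtain ⟨m, hm⟩ : ∃ m, p.2 = 2 * m := ⟨p.2 / 2, by omega⟩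
      exact hp2 (by simp [wronskiTerm, oddTerm, hm, oddSign_even])
    refine ⟨(p.1 / 10, p.2 / 10), ?_⟩
    ext <;> simp only [g] <;> omega

lemma exp_zpow_eq (y : ℝ) (m : ℤ) : Real.exp (-40 * y) ^ m = Real.exp (-40 * y * m) := by
  rw [← Real.rpow_intCast, ← Real.exp_mul]

lemma tsum_oddTerm_one {y : ℝ} (hy : 0 < y) :
    ∑' u, oddTerm 1 (5 * y) u =
      2 * Real.exp (-5 * y) * eulerProd (Real.exp (-40 * y)) ^ 3 := by
  set q := Real.exp (-40 * y) with hqdef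
  have hq0 : q ≠ 0 := (Real.exp_pos _).ne'
  have hq : ‖q‖ < 1 := by
    rw [Real.norm_of_nonneg (Real.exp_pos _).le, Real.exp_lt_one_iff]; linarith
  have hg : Function.Injective fun j : ℤ => 2 * j - 1 := fun a b h => by simpa using h
  have hz : ∑' j, thetaTerm q 1 j = 0 := by
    rw [← (Equiv.addRight (1 : ℤ)).tsum_eq]
    have h := tsum_neg_one_zpow_triangle_eq_zero q
    rw [← neg_eq_zero, ← tsum_neg] at h
    rw [← h]
    refine tsum_congr fun j => ?_
    simp only [Equiv.coe_addRight, thetaTerm, add_sub_cancel_right,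
      zpow_add_one₀ (show (-1 : ℝ) ≠ 0 by norm_num)]
    ring
  have s0 : Summable (thetaTerm q 1) := summable_thetaTerm hq0 hq one_ne_zero
  have s1 : Summable fun j : ℤ => (j : ℝ) * thetaTerm q 1 j := by
    refine Summable.of_norm ((summable_abs_pow_mul_thetaTerm hq0 hq
      (one_ne_zero : (1 : ℝ) ≠ 0) 1).congr fun j => ?_)
    rw [norm_mul, pow_one, Real.norm_eq_abs (j : ℝ)]
  -- Odd numbers are written u = 2j - 1, so that (u² - 1)/8 = j(j-1)/2. Of the two resulting series,
  -- the unweighted one vanishes and the other is Jacobi's.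
  have e : ∀ j : ℤ, oddTerm 1 (5 * y) (2 * j - 1) =
      Real.exp (-5 * y) * thetaTerm q 1 j - 2 * Real.exp (-5 * y) * (j * thetaTerm q 1 j) := by
    intro j
    rw [oddTerm, thetaTerm, hqdef, exp_zpow_eq, cast_triangle,
      show 2 * j - 1 = 2 * (j - 1) + 1 by ring, oddSign_one_add_two_mul,
      zpow_sub_one₀ (by norm_num)]
    push_cast
    rw [show -(2 * ((j : ℝ) - 1) + 1) ^ 2 * (5 * y) =
      -5 * y + -40 * y * (1 / 2 * (j : ℝ) ^ 2 + -1 / 2 * j) by ring, Real.exp_add]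
    norm_num
    ring
  rw [← hg.tsum_eq (f := oddTerm 1 (5 * y))]
  · rw [tsum_congr e, (s0.mul_left _).tsum_sub (s1.mul_left _), tsum_mul_left, tsum_mul_left, hz,
      tsum_mul_thetaTerm_one hq0 hq]
    ring
  · intro u hu
    by_cases h : u % 2 = 1
    · exact ⟨(u + 1) / 2, by simp only; omega⟩
    · obtain ⟨m, hm⟩ : ∃ m, u = 2 * m := ⟨u / 2, by omega⟩
      exact absurd (by simp [oddTerm, hm, oddSign_even]) hu

lemma oddTheta_one_eq (y : ℝ) :
    oddTheta 1 0 y = Real.exp (-y) * rrTheta 0 (Real.exp (-40 * y)) := by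
  rw [oddTheta, rrTheta, ← tsum_mul_left]
  refine tsum_congr fun j => ?_
  rw [oddTerm, exp_zpow_eq, cast_rrExp, show 10 * j + 1 = 2 * (5 * j) + 1 by ring,
    oddSign_one_add_two_mul, zpow_mul]
  push_cast
  rw [show -(2 * (5 * (j : ℝ)) + 1) ^ 2 * y =
    -y + -40 * y * (5 / 2 * (j : ℝ) ^ 2 + (1 + 2 * 0) / 2 * j) by ring, Real.exp_add,
    show ((-1 : ℝ) ^ (5 : ℤ)) = -1 by norm_num]
  ring

lemma oddTheta_seven_eq (y : ℝ) :
    oddTheta 7 0 y = Real.exp (-9 * y) * rrTheta 1 (Real.exp (-40 * y)) := by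
  rw [oddTheta, rrTheta, ← tsum_mul_left, ← (Equiv.subLeft (-1 : ℤ)).tsum_eq]
  refine tsum_congr fun j => ?_
  rw [Equiv.subLeft_apply, oddTerm, exp_zpow_eq, cast_rrExp,
    show 10 * (-1 - j) + 7 = 2 * (5 * (-j) - 2) + 1 by ring,
    oddSign_one_add_two_mul, zpow_sub₀ (by norm_num), zpow_mul, zpow_neg, ← inv_zpow]
  push_cast
  rw [show -(2 * (5 * (-(j : ℝ)) - 2) + 1) ^ 2 * y =
    -9 * y + -40 * y * (5 / 2 * (j : ℝ) ^ 2 + (1 + 2 * 1) / 2 * j) by ring, Real.exp_add,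
    show ((-1 : ℝ) ^ (5 : ℤ))⁻¹ = -1 by norm_num, show ((-1 : ℝ) ^ (2 : ℤ)) = 1 by norm_num]
  ring

/-- The Wronskian of the Rogers-Ramanujan theta functions is a power of the eta function. -/
theorem oddTheta_wronskian_eq {y : ℝ} (hy : 0 < y) :
    oddTheta 1 0 y * oddTheta 7 2 y - oddTheta 1 2 y * oddTheta 7 0 y =
      8 * Real.exp (-10 * y) * eulerProd (Real.exp (-40 * y)) ^ 6 := by
  have h := four_mul_tsum_residueLine hy
  rw [tsum_oddTerm_one hy] at h
  have e : Real.exp (-10 * y) = Real.exp (-5 * y) ^ 2 := by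
    rw [← Real.exp_nat_mul]; congr 1; push_cast; ring
  rw [oddTheta_wronskian hy, e]
  linear_combination h / 4

end Wronskian

/-! ### The derivative of R(e^{-πt}). -/

section Parametrization

/-- The Rogers-Ramanujan continued fraction at `q = exp(-πt)`. -/
noncomputable def rrExpPi (t : ℝ) : ℝ := rrR (Real.exp (-π * t))

lemma exp_neg_pi_mem {t : ℝ} (ht : 0 < t) : Real.exp (-π * t) ∈ Ioo (0 : ℝ) 1 :=
  ⟨Real.exp_pos _, Real.exp_lt_one_iff.mpr (by nlinarith [Real.pi_pos])⟩

lemma exp_neg_pi_log {q : ℝ} (hq : q ∈ Ioo (0 : ℝ) 1) :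
    0 < -Real.log q / π ∧ Real.exp (-π * (-Real.log q / π)) = q := by
  refine ⟨div_pos (neg_pos.mpr (Real.log_neg hq.1 hq.2)) Real.pi_pos, ?_⟩
  rw [show -π * (-Real.log q / π) = Real.log q by field_simp, Real.exp_log hq.1]

lemma rrExpPi_pos {t : ℝ} (ht : 0 < t) : 0 < rrExpPi t :=
  rrR_pos (exp_neg_pi_mem ht).1 (exp_neg_pi_mem ht).2

lemma rrExpPi_eq_oddTheta {t : ℝ} (ht : 0 < t) :
    rrExpPi t = oddTheta 7 0 (π / 40 * t) / oddTheta 1 0 (π / 40 * t) := by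
  obtain ⟨h0, h1⟩ := exp_neg_pi_mem ht
  have hp := (rrTheta_pos h0 h1).1
  rw [rrExpPi, rrR_eq h0 h1, oddTheta_one_eq, oddTheta_seven_eq,
    show -40 * (π / 40 * t) = -π * t by ring, ← Real.exp_mul]
  have e : Real.exp (-9 * (π / 40 * t)) =
      Real.exp (-π * t * (1 / 5)) * Real.exp (-(π / 40 * t)) := by
    rw [← Real.exp_add]; congr 1; ring
  rw [e]
  have := Real.exp_pos (-(π / 40 * t))
  field_simp

lemma hasDerivAt_rrExpPi {t : ℝ} (ht : 0 < t) :
    HasDerivAt rrExpPi (-(π / 5 * rrExpPi t * eulerProd (Real.exp (-π * t)) ^ 5 /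
      eulerProd (Real.exp (-π * t) ^ 5))) t := by
  obtain ⟨h0, h1⟩ := exp_neg_pi_mem ht
  obtain ⟨p0, p1⟩ := rrTheta_pos h0 h1
  have hE := eulerProd_pos h0 h1
  have hE5 := eulerProd_pos (q := Real.exp (-π * t) ^ 5) (by positivity)
    (pow_lt_one₀ h0.le h1 (by norm_num))
  have hy : 0 < π / 40 * t := by positivity
  have hlin : HasDerivAt (fun t : ℝ => π / 40 * t) (π / 40) t := by
    simpa using (hasDerivAt_id t).const_mul (π / 40)
  have e1 := oddTheta_one_eq (π / 40 * t)
  have e7 := oddTheta_seven_eq (π / 40 * t)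
  have hW := oddTheta_wronskian_eq hy
  rw [show -40 * (π / 40 * t) = -π * t by ring] at e1 e7 hW
  have hO1 : 0 < oddTheta 1 0 (π / 40 * t) := by rw [e1]; positivity
  have hO7 : 0 < oddTheta 7 0 (π / 40 * t) := by rw [e7]; positivity
  have d1 := (hasDerivAt_oddTheta hy 1).comp t hlin
  have d7 := (hasDerivAt_oddTheta hy 7).comp t hlin
  have hd := (d7.div d1 hO1.ne').congr_of_eventuallyEq (f₁ := rrExpPi) (by
    filter_upwards [isOpen_Ioi.mem_nhds ht] with x hx
    exact rrExpPi_eq_oddTheta hx)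
  refine hd.congr_deriv ?_
  -- Dividing the Wronskian by this product gives the logarithmic derivative of R, and the
  -- exponential factors cancel.
  have hP : oddTheta 1 0 (π / 40 * t) * oddTheta 7 0 (π / 40 * t) =
      Real.exp (-10 * (π / 40 * t)) *
        (eulerProd (Real.exp (-π * t)) * eulerProd (Real.exp (-π * t) ^ 5)) := by
    rw [← rrTheta_zero_mul_one h0.ne' (by rwa [Real.norm_of_nonneg h0.le]), e1, e7,
      show -10 * (π / 40 * t) = -(π / 40 * t) + -9 * (π / 40 * t) by ring, Real.exp_add]
    ring
  rw [rrExpPi_eq_oddTheta ht]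
  simp only [Function.comp_apply]
  set a := oddTheta 1 0 (π / 40 * t)
  set b := oddTheta 7 0 (π / 40 * t)
  set a' := oddTheta 1 2 (π / 40 * t)
  set b' := oddTheta 7 2 (π / 40 * t)
  set E := eulerProd (Real.exp (-π * t))
  set E' := eulerProd (Real.exp (-π * t) ^ 5)
  set x := Real.exp (-10 * (π / 40 * t))
  field_simp
  linear_combination (-5 * E') * hW + 40 * E ^ 5 * hP

lemma strictAntiOn_rrExpPi : StrictAntiOn rrExpPi (Ioi 0) := by
  refine strictAntiOn_of_deriv_neg (convex_Ioi 0)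
    (fun t ht => (hasDerivAt_rrExpPi ht).continuousAt.continuousWithinAt) fun t ht => ?_
  rw [interior_Ioi] at ht
  obtain ⟨h0, h1⟩ := exp_neg_pi_mem ht
  have hE := eulerProd_pos h0 h1
  have hE5 := eulerProd_pos (q := Real.exp (-π * t) ^ 5) (by positivity)
    (pow_lt_one₀ h0.le h1 (by norm_num))
  have hR := rrExpPi_pos ht
  rw [(hasDerivAt_rrExpPi ht).deriv]
  exact neg_neg_of_pos (by positivity)

lemma continuousOn_rrExpPi : ContinuousOn rrExpPi (Ioi 0) :=
  fun _ ht => (hasDerivAt_rrExpPi ht).continuousAt.continuousWithinAt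

/-! ### The range of R. -/

/-- The decreasing function that occurs in Ramanujan's quintic identity. -/
lemma quintic_lt_of_lt {x z : ℝ} (hx : 0 < x) (h : x < z) :
    (z ^ 5)⁻¹ - 11 - z ^ 5 < (x ^ 5)⁻¹ - 11 - x ^ 5 := by
  have h5 : x ^ 5 < z ^ 5 := pow_lt_pow_left₀ h hx.le (by norm_num)
  have h6 : (z ^ 5)⁻¹ < (x ^ 5)⁻¹ := inv_strictAnti₀ (by positivity) h5
  linarith

lemma golden_pos : 0 < (√5 - 1) / 2 := by
  have : 1 < √5 := by rw [Real.lt_sqrt (by norm_num)]; norm_num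
  linarith

lemma quintic_golden : (((√5 - 1) / 2) ^ 5)⁻¹ - 11 - ((√5 - 1) / 2) ^ 5 = 0 := by
  have h : √5 ^ 2 = 5 := Real.sq_sqrt (by norm_num)
  have h5 : ((√5 - 1) / 2) ^ 5 = (5 * √5 - 11) / 2 := by
    linear_combination (√5 ^ 3 / 32 - 5 * √5 ^ 2 / 32 + 15 * √5 / 32 - 35 / 32) * h
  have hp := pow_pos golden_pos 5
  rw [h5] at hp ⊢
  have e : ((5 * √5 - 11) / 2)⁻¹ = (5 * √5 + 11) / 2 :=
    inv_eq_of_mul_eq_one_right (by linear_combination 25 / 4 * h)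
  rw [e]
  ring

lemma rrExpPi_quintic {t : ℝ} (ht : 0 < t) :
    (rrExpPi t ^ 5)⁻¹ - 11 - rrExpPi t ^ 5 = eulerProd (Real.exp (-π * t)) ^ 6 /
      (Real.exp (-π * t) * eulerProd (Real.exp (-π * t) ^ 5) ^ 6) :=
  rrR_quintic (exp_neg_pi_mem ht).1 (exp_neg_pi_mem ht).2

/-- The quintic expression is positive at R, decreasing, and zero at (√5-1)/2. -/
lemma rrExpPi_lt_golden {t : ℝ} (ht : 0 < t) : rrExpPi t < (√5 - 1) / 2 := by
  obtain ⟨h0, h1⟩ := exp_neg_pi_mem ht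
  have hE := eulerProd_pos h0 h1
  have hE5 := eulerProd_pos (q := Real.exp (-π * t) ^ 5) (by positivity)
    (pow_lt_one₀ h0.le h1 (by norm_num))
  have h : 0 < (rrExpPi t ^ 5)⁻¹ - 11 - rrExpPi t ^ 5 := by
    rw [rrExpPi_quintic ht]; positivity
  by_contra! hle
  rcases hle.eq_or_lt with e | hlt
  · rw [← e, quintic_golden] at h
    exact lt_irrefl _ h
  · have := quintic_lt_of_lt golden_pos hlt
    rw [quintic_golden] at this
    linarith

lemma qPoch_nonneg {q : ℝ} (hq0 : 0 ≤ q) (hq : q ≤ 1) (n : ℕ) : 0 ≤ qPoch q n :=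
  Finset.prod_nonneg fun _ _ => sub_nonneg.mpr (pow_le_one₀ hq0 hq)

lemma eulerProd_le_one {q : ℝ} (hq0 : 0 < q) (hq : q < 1) : eulerProd q ≤ 1 := by
  have n1 : ‖q‖ < 1 := by rwa [Real.norm_of_nonneg hq0.le]
  refine le_of_tendsto' (tendsto_qPoch n1) fun n => ?_
  exact Finset.prod_le_one (fun _ _ => sub_nonneg.mpr (pow_le_one₀ hq0.le hq.le))
    fun _ _ => sub_le_self _ (by positivity)

lemma eulerProd_anti {p q : ℝ} (hp0 : 0 < p) (hpq : p ≤ q) (hq : q < 1) :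
    eulerProd q ≤ eulerProd p := by
  have hq0 := hp0.trans_le hpq
  have n1 : ‖q‖ < 1 := by rwa [Real.norm_of_nonneg hq0.le]
  have n2 : ‖p‖ < 1 := by rw [Real.norm_of_nonneg hp0.le]; exact hpq.trans_lt hq
  refine le_of_tendsto_of_tendsto' (tendsto_qPoch n1) (tendsto_qPoch n2) fun n => ?_
  exact Finset.prod_le_prod (fun _ _ => sub_nonneg.mpr (pow_le_one₀ hq0.le hq.le))
    fun _ _ => sub_le_sub_left (pow_le_pow_left₀ hp0.le hpq _) _

/-- For x ≥ 1/2 one has 1 + x + ⋯ + x^4 ≥ 3/2, so 1 - x ≤ (2/3)(1 - x^5). This applies to the first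
N factors; for the others 1 - x ≤ 1 - x^5 is enough. -/
lemma eulerProd_le_mul_eulerProd_pow {q : ℝ} (hq0 : 0 < q) (hq : q < 1) {N : ℕ}
    (hN : 1 / 2 ≤ q ^ N) : eulerProd q ≤ (2 / 3) ^ N * eulerProd (q ^ 5) := by
  have n1 : ‖q‖ < 1 := by rwa [Real.norm_of_nonneg hq0.le]
  have hq5 : q ^ 5 ≤ 1 := pow_le_one₀ hq0.le hq.le
  have A : ∀ n ≤ N, qPoch q n ≤ (2 / 3) ^ n * qPoch (q ^ 5) n := by
    intro n hn
    induction n with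
    | zero => simp [qPoch]
    | succ n ih =>
      have hx : 1 / 2 ≤ q ^ (n + 1) := hN.trans (pow_le_pow_of_le_one hq0.le hq.le hn)
      have hx1 : q ^ (n + 1) ≤ 1 := pow_le_one₀ hq0.le hq.le
      rw [qPoch_succ, qPoch_succ, ← pow_mul, mul_comm 5, pow_mul, pow_succ (2 / 3 : ℝ) n]
      generalize q ^ (n + 1) = x at hx hx1
      have hfac : 1 - x ≤ 2 / 3 * (1 - x ^ 5) := by
        have h3 : 3 / 2 ≤ 1 + x + x ^ 2 + x ^ 3 + x ^ 4 := by
          have : 0 ≤ x ^ 2 + x ^ 3 + x ^ 4 := by positivity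
          linarith
        nlinarith [mul_le_mul_of_nonneg_left h3 (sub_nonneg.mpr hx1)]
      calc _ ≤ ((2 / 3) ^ n * qPoch (q ^ 5) n) * (2 / 3 * (1 - x ^ 5)) :=
            mul_le_mul (ih (by omega)) hfac (sub_nonneg.mpr hx1)
              (mul_nonneg (by positivity) (qPoch_nonneg (by positivity) hq5 n))
        _ = _ := by ring
  have B : ∀ m, qPoch q (N + m) ≤ (2 / 3) ^ N * qPoch (q ^ 5) (N + m) := by
    intro m
    induction m with
    | zero => exact A N le_rfl
    | succ m ih =>
      rw [← add_assoc, qPoch_succ, qPoch_succ, ← mul_assoc]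
      refine mul_le_mul ih (sub_le_sub_left ?_ _) (sub_nonneg.mpr (pow_le_one₀ hq0.le hq.le))
        (mul_nonneg (by positivity) (qPoch_nonneg (by positivity) hq5 _))
      refine pow_le_pow_left₀ (by positivity) ?_ _
      simpa using pow_le_pow_of_le_one hq0.le hq.le (show 1 ≤ 5 by norm_num)
  have hadd : Tendsto (fun m => N + m) atTop atTop := tendsto_add_atTop_nat N |>.congr
    fun m => add_comm m N
  exact le_of_tendsto_of_tendsto' ((tendsto_qPoch n1).comp hadd)
    (((tendsto_qPoch (norm_pow_lt_one n1 (show 5 ≠ 0 by norm_num))).comp hadd).const_mul _) B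

lemma exists_lt_rrExpPi {x : ℝ} (hx : x ∈ Ioo 0 ((√5 - 1) / 2)) : ∃ t, 0 < t ∧ x < rrExpPi t := by
  have hpos := quintic_lt_of_lt hx.1 hx.2
  rw [quintic_golden] at hpos
  obtain ⟨N, hN⟩ := exists_pow_lt_of_lt_one (half_pos hpos) (show (2 / 3 : ℝ) < 1 by norm_num)
  set M := N + 1
  have hM : (2 / 3 : ℝ) ^ M < ((x ^ 5)⁻¹ - 11 - x ^ 5) / 2 :=
    (pow_le_pow_of_le_one (by norm_num) (by norm_num) (Nat.le_succ N)).trans_lt hN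
  have hM0 : (0 : ℝ) < M := by positivity
  have hl := Real.log_pos one_lt_two
  -- This t gives q^M = 1/2, so the quintic expression at R is at most 2 (2/3)^M, below its value at
  -- x. Taking M = N + 1 makes M positive.
  set t := Real.log 2 / (π * M) with htdef
  have ht : 0 < t := by positivity
  refine ⟨t, ht, ?_⟩
  obtain ⟨h0, h1⟩ := exp_neg_pi_mem ht
  have hu := rrExpPi_quintic ht
  have hpow : Real.exp (-π * t) ^ M = 1 / 2 := by
    rw [← Real.exp_nat_mul, show (M : ℝ) * (-π * t) = -Real.log 2 by rw [htdef]; field_simp,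
      Real.exp_neg, Real.exp_log two_pos, one_div]
  have hle := eulerProd_le_mul_eulerProd_pow h0 h1 hpow.ge
  have hq2 : 1 / 2 ≤ Real.exp (-π * t) := by
    rw [← hpow]
    simpa using pow_le_pow_of_le_one h0.le h1.le (show 1 ≤ M by omega)
  have hE := eulerProd_pos h0 h1
  have hE5 := eulerProd_pos (q := Real.exp (-π * t) ^ 5) (by positivity)
    (pow_lt_one₀ h0.le h1 (by norm_num))
  generalize Real.exp (-π * t) = q at *
  have hb : eulerProd q ^ 6 / (q * eulerProd (q ^ 5) ^ 6) ≤ 2 * (2 / 3) ^ M := by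
    rw [div_le_iff₀ (by positivity)]
    have h6 : eulerProd q ^ 6 ≤ ((2 / 3) ^ M * eulerProd (q ^ 5)) ^ 6 :=
      pow_le_pow_left₀ hE.le hle 6
    have hc : ((2 / 3 : ℝ) ^ M) ^ 6 ≤ (2 / 3) ^ M :=
      pow_le_of_le_one (by positivity) (pow_le_one₀ (by norm_num) (by norm_num)) (by norm_num)
    calc _ ≤ ((2 / 3 : ℝ) ^ M) ^ 6 * eulerProd (q ^ 5) ^ 6 := by rwa [← mul_pow]
      _ ≤ (2 / 3) ^ M * eulerProd (q ^ 5) ^ 6 := by gcongr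
      _ = 2 * (2 / 3) ^ M * (1 / 2 * eulerProd (q ^ 5) ^ 6) := by ring
      _ ≤ _ := by gcongr
  by_contra! hle'
  have hR := rrExpPi_pos ht
  have h3 : (x ^ 5)⁻¹ - 11 - x ^ 5 ≤ (rrExpPi t ^ 5)⁻¹ - 11 - rrExpPi t ^ 5 := by
    rcases hle'.eq_or_lt with e | hlt
    · rw [e]
    · exact (quintic_lt_of_lt hR hlt).le
  linarith

/-- For t ≥ 1, E(q) stays above its value at t = 1 while E(q^5) ≤ 1, so the quintic identity forces
R^{-5} to grow at least like a constant times 1/q. -/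
lemma exists_rrExpPi_lt {x : ℝ} (hx : 0 < x) (a : ℝ) : ∃ t, a < t ∧ 0 < t ∧ rrExpPi t < x := by
  obtain ⟨g0, g1⟩ := exp_neg_pi_mem one_pos
  have hC := eulerProd_pos g0 g1
  set C := eulerProd (Real.exp (-π * 1))
  have hlim : Tendsto (fun t : ℝ => Real.exp (-π * t)) atTop (𝓝 0) :=
    Real.tendsto_exp_atBot.comp (tendsto_id.const_mul_atTop_of_neg (neg_neg_of_pos Real.pi_pos))
  have hev := (hlim.eventually_lt_const (show 0 < x ^ 5 * C ^ 6 by positivity)).and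
    ((eventually_gt_atTop a).and (eventually_ge_atTop 1))
  obtain ⟨t, hlt, hat, h1t⟩ := hev.exists
  have ht : 0 < t := by linarith
  refine ⟨t, hat, ht, ?_⟩
  obtain ⟨h0, h1⟩ := exp_neg_pi_mem ht
  have hu := rrExpPi_quintic ht
  have hE : C ≤ eulerProd (Real.exp (-π * t)) :=
    eulerProd_anti h0 (Real.exp_le_exp.mpr (by nlinarith [Real.pi_pos])) g1
  have h05 : Real.exp (-π * t) ^ 5 < 1 := pow_lt_one₀ h0.le h1 (by norm_num)
  have hE5 := eulerProd_pos (q := Real.exp (-π * t) ^ 5) (by positivity) h05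
  have hE5' := eulerProd_le_one (q := Real.exp (-π * t) ^ 5) (by positivity) h05
  have hR := rrExpPi_pos ht
  generalize Real.exp (-π * t) = q at *
  have hb : C ^ 6 / q ≤ (rrExpPi t ^ 5)⁻¹ := by
    calc _ ≤ eulerProd q ^ 6 / q := by gcongr
      _ ≤ eulerProd q ^ 6 / (q * eulerProd (q ^ 5) ^ 6) := by
        refine div_le_div_of_nonneg_left (by positivity) (by positivity) ?_
        exact mul_le_of_le_one_right h0.le (pow_le_one₀ hE5.le hE5')
      _ ≤ _ := by rw [← hu]; linarith [pow_pos hR 5]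
  have h5 : rrExpPi t ^ 5 < x ^ 5 := by
    rw [le_inv_comm₀ (by positivity) (by positivity), inv_div] at hb
    refine hb.trans_lt ?_
    rwa [div_lt_iff₀ (by positivity)]
  exact lt_of_pow_lt_pow_left₀ 5 hx.le h5

lemma image_rrExpPi_Ioi {a : ℝ} (ha : 0 < a) : rrExpPi '' Ioi a = Ioo 0 (rrExpPi a) := by
  ext x
  constructor
  · rintro ⟨t, ht, rfl⟩
    exact ⟨rrExpPi_pos (ha.trans ht), strictAntiOn_rrExpPi ha (ha.trans ht) ht⟩
  · rintro ⟨hx0, hx1⟩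
    obtain ⟨t, hat, -, htx⟩ := exists_rrExpPi_lt hx0 a
    obtain ⟨c, hc, rfl⟩ := intermediate_value_Ioo' hat.le
      (continuousOn_rrExpPi.mono fun z hz => ha.trans_le hz.1) ⟨htx, hx1⟩
    exact ⟨c, hc.1, rfl⟩

lemma exists_rrExpPi_eq {x : ℝ} (hx : x ∈ Ioo 0 ((√5 - 1) / 2)) : ∃ t, 0 < t ∧ rrExpPi t = x := by
  obtain ⟨a, ha, hxa⟩ := exists_lt_rrExpPi hx
  have h : x ∈ rrExpPi '' Ioi a := by rw [image_rrExpPi_Ioi ha]; exact ⟨hx.1, hxa⟩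
  obtain ⟨t, ht, rfl⟩ := h
  exact ⟨t, ha.trans ht, rfl⟩

lemma injOn_rrR : InjOn rrR (Ioo 0 1) := by
  intro p hp q hq h
  obtain ⟨h1, e1⟩ := exp_neg_pi_log hp
  obtain ⟨h2, e2⟩ := exp_neg_pi_log hq
  have h3 := strictAntiOn_rrExpPi.injOn h1 h2 (by simp only [rrExpPi, e1, e2]; exact h)
  rw [← e1, h3, e2]

/-! ### The change of variables and the modular equation. -/

lemma eta_half_I_mul {t : ℝ} (ht : 0 < t) : ModularForm.eta (Complex.I * t / 2) =
    ((Real.exp (-π * t / 24) * eulerProd (Real.exp (-π * t)) : ℝ) : ℂ) := by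
  obtain ⟨h0, h1⟩ := exp_neg_pi_mem ht
  have e : Complex.exp (2 * π * Complex.I * (Complex.I * t / 2)) =
      ((Real.exp (-π * t) : ℝ) : ℂ) := by
    rw [Complex.ofReal_exp]
    congr 1
    push_cast
    linear_combination (π * t : ℂ) * Complex.I_mul_I
  have e24 : Function.Periodic.qParam 24 (Complex.I * t / 2) =
      ((Real.exp (-π * t / 24) : ℝ) : ℂ) := by
    rw [Function.Periodic.qParam, Complex.ofReal_exp]
    congr 1
    push_cast
    linear_combination (π * t / 24 : ℂ) * Complex.I_mul_I
  rw [ModularForm.eta, e24, Complex.ofReal_mul,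
    ofReal_eulerProd (by rwa [Real.norm_of_nonneg h0.le]), eulerProd]
  congr 1
  refine tprod_congr fun n => ?_
  rw [ModularForm.eta_q_eq_pow, e]

/-- The substitution `x = R(exp(-πt))` in the integrand. -/
lemma mIntegrand_eq (G : ℝ → ℝ) {t : ℝ} (ht : 0 < t) :
    5 * (|-(π / 5 * rrExpPi t * eulerProd (Real.exp (-π * t)) ^ 5 /
      eulerProd (Real.exp (-π * t) ^ 5))| • (G (rrExpPi t) /
      (rrExpPi t * ((rrExpPi t ^ 5)⁻¹ - 11 - rrExpPi t ^ 5) ^ (1 / 6 : ℝ)))) =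
      π * mIntegrand G t := by
  obtain ⟨h0, h1⟩ := exp_neg_pi_mem ht
  have hE := eulerProd_pos h0 h1
  have hE5 := eulerProd_pos (q := Real.exp (-π * t) ^ 5) (by positivity)
    (pow_lt_one₀ h0.le h1 (by norm_num))
  have hR := rrExpPi_pos ht
  have hx := Real.exp_pos (-π * t / 24)
  -- The sixth root becomes explicit in terms of e^{-πt/24} = q^{1/24}, the prefactor of η(it/2).
  have hq : Real.exp (-π * t) = (Real.exp (-π * t / 24) ^ 4) ^ 6 := by
    rw [← pow_mul, ← Real.exp_nat_mul]; congr 1; push_cast; ring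
  have hroot : ((rrExpPi t ^ 5)⁻¹ - 11 - rrExpPi t ^ 5) ^ (1 / 6 : ℝ) =
      eulerProd (Real.exp (-π * t)) / (Real.exp (-π * t / 24) ^ 4 *
        eulerProd (Real.exp (-π * t) ^ 5)) := by
    have e : (rrExpPi t ^ 5)⁻¹ - 11 - rrExpPi t ^ 5 = (eulerProd (Real.exp (-π * t)) /
        (Real.exp (-π * t / 24) ^ 4 * eulerProd (Real.exp (-π * t) ^ 5))) ^ 6 := by
      rw [rrExpPi_quintic ht, div_pow, mul_pow, ← hq]
    rw [e, ← Real.rpow_natCast, ← Real.rpow_mul (by positivity)]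
    norm_num
  have heta : (ModularForm.eta (Complex.I * t / 2) ^ 4).re =
      (Real.exp (-π * t / 24) * eulerProd (Real.exp (-π * t))) ^ 4 := by
    rw [eta_half_I_mul ht, ← Complex.ofReal_pow, Complex.ofReal_re]
  rw [hroot, mIntegrand, heta, abs_neg, abs_of_pos (by positivity), smul_eq_mul]
  rw [show rrR (Real.exp (-π * t)) = rrExpPi t from rfl]
  generalize eulerProd (Real.exp (-π * t) ^ 5) = E5 at hE5
  generalize eulerProd (Real.exp (-π * t)) = E at hE
  field_simp

lemma yIntegral_rrExpPi (G : ℝ → ℝ) {r : ℝ} (hr : 0 < r) :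
    yIntegral G (rrExpPi √r) = mInv G r := by
  have ha : 0 < √r := Real.sqrt_pos.mpr hr
  have hsub : Ioi √r ⊆ Ioi 0 := fun t ht => ha.trans ht
  rw [yIntegral, mInv, ← image_rrExpPi_Ioi ha,
    MeasureTheory.integral_image_eq_integral_abs_deriv_smul measurableSet_Ioi
      (fun t ht => (hasDerivAt_rrExpPi (hsub ht)).hasDerivWithinAt)
      (strictAntiOn_rrExpPi.injOn.mono hsub), ← MeasureTheory.integral_const_mul,
    ← MeasureTheory.integral_const_mul]
  exact MeasureTheory.setIntegral_congr_fun measurableSet_Ioi fun t ht =>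
    mIntegrand_eq G (hsub ht)

/-- The value chosen by `yFun` is some R(e^{-πt}), whose integral is `mInv G (t ^ 2)`. Injectivity
of `mInv` forces t² = r. -/
lemma yFun_mInv {G : ℝ → ℝ} (hinj : InjOn (mInv G) (Ioi 0)) {r : ℝ} (hr : 0 < r) :
    yFun G (mInv G r) = rrExpPi √r := by
  have ha : 0 < √r := Real.sqrt_pos.mpr hr
  have hex : ∃ y ∈ Ioo 0 ((√5 - 1) / 2), yIntegral G y = mInv G r :=
    ⟨rrExpPi √r, ⟨rrExpPi_pos ha, rrExpPi_lt_golden ha⟩, yIntegral_rrExpPi G hr⟩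
  have hmem : yFun G (mInv G r) ∈ Ioo 0 ((√5 - 1) / 2) := Function.invFunOn_mem hex
  have heq : yIntegral G (yFun G (mInv G r)) = mInv G r := Function.invFunOn_eq hex
  obtain ⟨t, ht, hty⟩ := exists_rrExpPi_eq hmem
  have ht2 : 0 < t ^ 2 := by positivity
  rw [← hty, ← Real.sqrt_sq ht.le, yIntegral_rrExpPi G ht2] at heq
  rw [← hty, ← hinj ht2 hr heq, Real.sqrt_sq ht.le]

lemma rrOmega_rrR (n : ℕ) {q : ℝ} (hq : q ∈ Ioo (0 : ℝ) 1) : rrOmega n (rrR q) = rrR (q ^ n) := by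
  rw [rrOmega, injOn_rrR.leftInvOn_invFunOn hq]

end Parametrization

theorem theorem5 (G : ℝ → ℝ)
    (hG : ContDiffOn ℝ ∞ G (Ioo 0 ((√5 - 1) / 2)))
    (hconv : ∀ r : ℝ, 0 < r → MeasureTheory.IntegrableOn (mIntegrand G) (Ioi √r))
    (hinj : InjOn (mInv G) (Ioi 0))
    (n : ℕ) (hn : 1 ≤ n) :
    (∀ q ∈ Ioo (0 : ℝ) 1, rrR (q ^ n) = rrOmega n (rrR q)) ∧
    ∀ A ∈ mInv G '' Ioi 0, yFun G (QStar G ((n : ℝ) ^ 2) A) = rrOmega n (yFun G A) := by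
  refine ⟨fun q hq => (rrOmega_rrR n hq).symm, ?_⟩
  rintro _ ⟨r, hr, rfl⟩
  have hr' : 0 < r := hr
  have hn0 : (0 : ℝ) < n := by exact_mod_cast hn
  have hm : mFun G (mInv G r) = r := hinj.leftInvOn_invFunOn hr
  -- Since √(n² r) = n√r, the new argument e^{-πn√r} is the n-th power of e^{-π√r}.
  rw [QStar, hm, yFun_mInv hinj (by positivity), yFun_mInv hinj hr',
    Real.sqrt_mul (by positivity), Real.sqrt_sq hn0.le, rrExpPi, rrExpPi,
    rrOmega_rrR n (exp_neg_pi_mem (Real.sqrt_pos.mpr hr')), ← Real.exp_nat_mul]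
  congr 2
  ring
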